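/- A permutation $\sigma$ of $[n]=\{1,\dots,n\}$ is *square* if each of its points $(i,\sigma(i))$ is a record, i.e. a left-to-right maximum, a left-to-right minimum, a right-to-left maximum or a right-to-left minimum. Let $Sq(n)$ be the set of square permutations of $[n]$, let $\boldsymbol\sigma_n$ be uniform in $Sq(n)$, and let $\boldsymbol i_n$ be uniform in $[n]$, independent of $\boldsymbol\sigma_n$. Let $\mathcal S^m$ be the set of permutations of size $m$, and write $|\pi|$ for the size of $\pi$. A rooted permutation is a pair $(A,\preccurlyeq)$ consisting of an interval $A\subseteq\mathbb Z$ with $0\in A$ and a total order $\preccurlyeq$ on $A$. A permutation $\sigma$ of $[n]$ with a root $i\in[n]$ is identified with the interval $[1-i,n-i]$ ordered by $\ell\preccurlyeq m\iff\sigma(\ell+i)\le\sigma(m+i)$. The $h$-restriction around the root is $r_h(A,\preccurlyeq)=(A\cap[-h,h],\preccurlyeq)$. For $h\ge1$, $j\in\{1,2,3,4\}$ and $\mathcal D\subseteq[2h+1]$ with complement $\mathcal U=[2h+1]\setminus\mathcal D$, let $\psi_h(j,\mathcal D)=(\pi,h+1)$, where $\pi\in\mathcal S^{2h+1}$ is the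 unique permutation such that $\pi(a)<\pi(b)$ for all $a\in\mathcal D$, $b\in\mathcal U$, and such that $\pi|_{\mathcal D}$ and $\pi|_{\mathcal U}$ are, respectively, increasing and increasing if $j=1$; decreasing and increasing if $j=2$; increasing and decreasing if $j=3$; decreasing and decreasing if $j=4$. Define the following families of permutations $\pi$ of size $2h+1$, $h\ge1$ (a permutation is monotone if it is increasing or decreasing): - $\mathcal A_1$: the non-monotone $\pi$ with $(\pi,h+1)=\psi_h(1,\mathcal D)$ for some $\mathcal D$; - $\mathcal A_2$: the $\pi$ with $(\pi,h+1)=\psi_h(2,\mathcal D)$ for some $\mathcal D$; - $\mathcal A_3$: the $\pi$ with $(\pi,h+1)=\psi_h(3,\mathcal D)$ for some $\mathcal D$; - $\mathcal A_4$: the non-monotone $\pi$ with $(\pi,h+1)=\psi_h(4,\mathcal D)$ for some $\mathcal D$; - $\mathcal A_5$: the increasing permutations; - $\mathcal A_6$: the decreasing permutations. **Corollary 6.6.** For every integer $h\ge1$ and every $\pi\in\mathcal S^{2h+1}$, $$\mathbb P\big(r_h(\boldsymbol\sigma_n,\boldsymbol i_n)=(\pi,h+1)\big)\longrightarrow p(\pi)\qquad(n\to\infty),$$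 where $$p(\pi)=2^{-|\pi|-2}\Big(\mathbf 1_{\mathcal A_1}(\pi)+2\cdot\mathbf 1_{\mathcal A_2}(\pi)+2\cdot\mathbf 1_{\mathcal A_3}(\pi)+\mathbf 1_{\mathcal A_4}(\pi)+(|\pi|+1)\,\mathbf 1_{\mathcal A_5\cup\mathcal A_6}(\pi)\Big).$$ -/

import Mathlib

open MeasureTheory ProbabilityTheory Filter Topology

namespace SquarePerm

/-! ### Square permutations -/

/-- The point `(i, σ i)` is a record of `σ`: a left-to-right maximum, a left-to-right minimum,
a right-to-left maximum or a right-to-left minimum. -/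
def IsRecord {n : ℕ} (σ : Equiv.Perm (Fin n)) (i : Fin n) : Prop :=
  (∀ j, j < i → σ j < σ i) ∨ (∀ j, j < i → σ i < σ j) ∨
    (∀ j, i < j → σ j < σ i) ∨ (∀ j, i < j → σ i < σ j)

/-- The set `Sq(n)` of square permutations of size `n`: every point is a record.
Positions and values are numbered `0, …, n - 1`. -/
def Sq (n : ℕ) : Set (Equiv.Perm (Fin n)) :=
  {σ | ∀ i, IsRecord σ i}

/-! ### Rooted permutations and restrictions around the root -/

/-- A (finite or infinite) rooted permutation: an interval of integers containing `0` (the root)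
together with a total order on it. The order is recorded as a relation on `ℤ` that holds only
between points of the interval, so that equality of structures is equality of the interval and
of the order on it. -/
@[ext]
structure RootedPerm where
  carrier : Set ℤ
  le : ℤ → ℤ → Prop
  ordConnected : carrier.OrdConnected
  zero_mem : (0 : ℤ) ∈ carrier
  mem_of_le : ∀ a b, le a b → a ∈ carrier ∧ b ∈ carrier
  le_total : ∀ a ∈ carrier, ∀ b ∈ carrier, le a b ∨ le b a
  le_trans : ∀ a b c, le a b → le b c → le a c
  le_antisymm : ∀ a b, le a b → le b a → a = b

/-- The total order associated with a permutation `σ` of size `n` rooted at the index `i`: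
columns are shifted so that the root is in column `0`, and
`ℓ` is below `m` when `σ (ℓ + i) ≤ σ (m + i)`. -/
def ofPerm {n : ℕ} (σ : Equiv.Perm (Fin n)) (i : Fin n) : RootedPerm where
  carrier := {l | ∃ a : Fin n, (a : ℤ) = l + i}
  le l m := ∃ a b : Fin n, (a : ℤ) = l + i ∧ (b : ℤ) = m + i ∧ σ a ≤ σ b
  ordConnected := by
    refine ⟨?_⟩
    rintro x ⟨a, ha⟩ y ⟨b, hb⟩ z ⟨hxz, hzy⟩
    have := a.isLt
    have := b.isLt
    refine ⟨⟨(z + i).toNat, by omega⟩, ?_⟩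
    simp only
    omega
  zero_mem := ⟨i, by simp⟩
  mem_of_le := by
    rintro l m ⟨a, b, ha, hb, -⟩
    exact ⟨⟨a, ha⟩, ⟨b, hb⟩⟩
  le_total := by
    rintro l ⟨a, ha⟩ m ⟨b, hb⟩
    rcases _root_.le_total (σ a) (σ b) with h | h
    · exact Or.inl ⟨a, b, ha, hb, h⟩
    · exact Or.inr ⟨b, a, hb, ha, h⟩
  le_trans := by
    rintro l m k ⟨a, b, ha, hb, h⟩ ⟨b', c, hb', hc, h'⟩
    have hbb : b = b' := by
      apply Fin.ext
      omega
    subst hbb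
    exact ⟨a, c, ha, hc, h.trans h'⟩
  le_antisymm := by
    rintro l m ⟨a, b, ha, hb, h⟩ ⟨b', a', hb', ha', h'⟩
    have hbb : b = b' := by
      apply Fin.ext
      omega
    have haa : a = a' := by
      apply Fin.ext
      omega
    subst hbb haa
    have hab : a = b := σ.injective (_root_.le_antisymm h h')
    subst hab
    omega

/-- The `h`-restriction `r_h` around the root: the order induced on `A ∩ [-h, h]`. -/
def restrict (h : ℕ) (T : RootedPerm) : RootedPerm where
  carrier := T.carrier ∩ Set.Icc (-(h : ℤ)) h
  le a b := a ∈ Set.Icc (-(h : ℤ)) h ∧ b ∈ Set.Icc (-(h : ℤ)) h ∧ T.le a b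
  ordConnected := T.ordConnected.inter Set.ordConnected_Icc
  zero_mem := ⟨T.zero_mem, by simp⟩
  mem_of_le := by
    rintro a b ⟨ha, hb, hab⟩
    exact ⟨⟨(T.mem_of_le a b hab).1, ha⟩, ⟨(T.mem_of_le a b hab).2, hb⟩⟩
  le_total := by
    rintro a ⟨ha, ha'⟩ b ⟨hb, hb'⟩
    rcases T.le_total a ha b hb with h | h
    · exact Or.inl ⟨ha', hb', h⟩
    · exact Or.inr ⟨hb', ha', h⟩
  le_trans := by
    rintro a b c ⟨ha, -, hab⟩ ⟨-, hc, hbc⟩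
    exact ⟨ha, hc, T.le_trans a b c hab hbc⟩
  le_antisymm := by
    rintro a b ⟨-, -, hab⟩ ⟨-, -, hba⟩
    exact T.le_antisymm a b hab hba

/-! ### The random rooted square permutation -/

/-- Permutations of a finite set carry the discrete σ-algebra. -/
instance instMeasurableSpacePerm (n : ℕ) : MeasurableSpace (Equiv.Perm (Fin n)) := ⊤

instance instDiscreteMeasurableSpacePerm (n : ℕ) :
    DiscreteMeasurableSpace (Equiv.Perm (Fin n)) :=
  ⟨fun _ => trivial⟩

/-- The joint law of `(σ, i)`, where `σ` is uniform in `Sq(n)` and `i` is a uniform index,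
independent of `σ` (for `n = 0` there is no index and this is the zero measure). -/
noncomputable def rootedLaw (n : ℕ) : Measure (Equiv.Perm (Fin n) × Fin n) :=
  (uniformOn (Sq n)).prod (uniformOn (Set.univ : Set (Fin n)))

/-! ### The limiting probabilities -/

/-- The four shapes: for `j = 1, 2, 3, 4`, the lower and the upper points are, respectively,
increasing and increasing; decreasing and increasing; increasing and decreasing; decreasing and
decreasing. -/
inductive Shape
  | one
  | two
  | three
  | four

/-- `IsPsi h j D π` says that `(π, h + 1) = ψ_h(j, D)`: all values of `π` on `D` lie below all
values on the complement `U` of `D`, and the patterns of `π` on `D` and on `U` are monotone in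
the directions prescribed by `j`. (These conditions determine `π` from `j` and `D`.) -/
def IsPsi (h : ℕ) (j : Shape) (D : Set (Fin (2 * h + 1)))
    (π : Equiv.Perm (Fin (2 * h + 1))) : Prop :=
  (∀ a ∈ D, ∀ b ∈ Dᶜ, π a < π b) ∧
    match j with
    | .one => StrictMonoOn π D ∧ StrictMonoOn π Dᶜ
    | .two => StrictAntiOn π D ∧ StrictMonoOn π Dᶜ
    | .three => StrictMonoOn π D ∧ StrictAntiOn π Dᶜ
    | .four => StrictAntiOn π D ∧ StrictAntiOn π Dᶜ

/-- A permutation is monotone if it is increasing or decreasing. -/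
def IsMonotonePerm {n : ℕ} (π : Equiv.Perm (Fin n)) : Prop :=
  StrictMono π ∨ StrictAnti π

/-- Members of size `2h + 1` of the family `A_1`. -/
def A₁ (h : ℕ) : Set (Equiv.Perm (Fin (2 * h + 1))) :=
  {π | ¬ IsMonotonePerm π ∧ ∃ D, IsPsi h .one D π}

/-- Members of size `2h + 1` of the family `A_2`. -/
def A₂ (h : ℕ) : Set (Equiv.Perm (Fin (2 * h + 1))) :=
  {π | ∃ D, IsPsi h .two D π}

/-- Members of size `2h + 1` of the family `A_3`. -/
def A₃ (h : ℕ) : Set (Equiv.Perm (Fin (2 * h + 1))) :=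
  {π | ∃ D, IsPsi h .three D π}

/-- Members of size `2h + 1` of the family `A_4`. -/
def A₄ (h : ℕ) : Set (Equiv.Perm (Fin (2 * h + 1))) :=
  {π | ¬ IsMonotonePerm π ∧ ∃ D, IsPsi h .four D π}

/-- Members of size `2h + 1` of the family `A_5`: the increasing permutation. -/
def A₅ (h : ℕ) : Set (Equiv.Perm (Fin (2 * h + 1))) :=
  {π | StrictMono π}

/-- Members of size `2h + 1` of the family `A_6`: the decreasing permutation. -/
def A₆ (h : ℕ) : Set (Equiv.Perm (Fin (2 * h + 1))) :=
  {π | StrictAnti π}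

/-- The indicator function of a set, with real values. -/
noncomputable def ind {α : Type*} (A : Set α) : α → ℝ :=
  A.indicator 1

/-- The limiting probability `p(π)` of a pattern `π` of size `|π| = 2h + 1`. -/
noncomputable def p (h : ℕ) (π : Equiv.Perm (Fin (2 * h + 1))) : ℝ :=
  (2 : ℝ) ^ (-((2 * h + 1 : ℕ) : ℤ) - 2) *
    (ind (A₁ h) π + 2 * ind (A₂ h) π + 2 * ind (A₃ h) π + ind (A₄ h) π
      + (((2 * h + 1 : ℕ) : ℝ) + 1) * ind (A₅ h ∪ A₆ h) π)

end SquarePerm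

namespace SquarePerm

/-! A square permutation is encoded by the column `z` of its lowest point, a low/high label `X` for
each column and a left/right label `Y` for each row. The encoding is injective and forces `true` at
the two extreme columns, at `z` and at the two extreme rows, so `card_Sq_le` bounds the number of
square permutations by `(n + 2) * 2 ^ (n - 3) * 2 ^ (n - 2)`.

Conversely, from `(z, X, Y)` a permutation is drawn by walking clockwise around the diagram from its
lowest point and matching the k-th visited column with the k-th visited row. If every prefix of `X`
and of `Y` is half `true` up to an error `e`, and `z` is far from the ends, the result stays within
`3 * e` of a rectangle with sides of slope ±1. It is then square (`Good.mem_Sq`) and determines `(z,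
X, Y)` (`Good.unique`). A fourth moment bound shows that almost all labels are balanced when `e` is
about `n ^ (9/10)`, so this construction yields asymptotically all square permutations.

Near a root `i` away from the corners of the rectangle, the diagram consists of two well separated
monotone branches. Their directions depend only on which of the four triangles cut out by the
diagonals of the square contains `(z, i)`, and the columns on the lower branch are read off from `X`
(`Good.window`). Each triangle has asymptotic weight 1/4 and the labels in the window are free, so
the limit of the probability of `π` is at least the number of pairs `(j, D)` with `ψ_h(j, D) = (π, h
+ 1)`, divided by `4 * 2 ^ (2 * h + 1)`. This ratio is `p h π` (`p_eq`).

Only lower bounds are proved directly. The events for distinct `π` are disjoint and the numbers `p h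
π` sum to 1 (`sum_p`), so the lower bounds for the other patterns give the matching upper bound. -/

/-! ### Permutations from sorting keys, and counting of pinned labels -/

/-- Two injective integer keys on `Fin n` are matched by a unique permutation. -/
theorem exists_perm_of_keys {n : ℕ} (f g : Fin n → ℤ) (hf : Function.Injective f)
    (hg : Function.Injective g) :
    ∃ σ : Equiv.Perm (Fin n), ∀ a b, f a < f b ↔ g (σ a) < g (σ b) := by
  classical
  have key : ∀ f : Fin n → ℤ, Function.Injective f →
      ∃ s : Equiv.Perm (Fin n), StrictMono (f ∘ s) := by
    intro f hf
    refine ⟨Tuple.sort f, ?_⟩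
    exact (Tuple.monotone_sort f).strictMono_of_injective
      (hf.comp (Tuple.sort f).injective)
  obtain ⟨s, hs⟩ := key f hf
  obtain ⟨t, ht⟩ := key g hg
  refine ⟨s.symm.trans t, fun a b => ?_⟩
  have h1 := hs.lt_iff_lt (a := s.symm a) (b := s.symm b)
  have h2 := ht.lt_iff_lt (a := s.symm a) (b := s.symm b)
  simp only [Function.comp_apply, Equiv.apply_symm_apply] at h1 h2
  simp only [Equiv.trans_apply]
  rw [h1, h2]

theorem perm_ext_of_lt {n : ℕ} (σ τ : Equiv.Perm (Fin n))
    (h : ∀ a b, σ a < σ b → τ a < τ b) : σ = τ := by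
  have hm : StrictMono (fun x => τ (σ.symm x)) := by
    intro x y hxy
    apply h
    simpa using hxy
  have e : (fun x => τ (σ.symm x)) = id := by
    refine (hm.range_inj strictMono_id).1 ?_
    rw [Set.range_id]
    exact (σ.symm.trans τ).surjective.range_eq
  ext a
  have := congrFun e (σ a)
  simp at this
  rw [this]

theorem card_pinned {n : ℕ} (S : Finset (Fin n)) (f : Fin n → Bool) :
    (Finset.univ.filter fun X : Fin n → Bool => ∀ s ∈ S, X s = f s).card = 2 ^ (n - S.card) := by
  classical
  have : (Finset.univ.filter fun X : Fin n → Bool => ∀ s ∈ S, X s = f s) =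
      Fintype.piFinset (fun s => if s ∈ S then {f s} else Finset.univ) := by
    ext X
    simp only [Finset.mem_filter, Finset.mem_univ, true_and, Fintype.mem_piFinset]
    refine forall_congr' fun s => ?_
    by_cases hs : s ∈ S <;> simp [hs]
  rw [this, Fintype.card_piFinset]
  have h2 : ∀ s : Fin n, (if s ∈ S then {f s} else (Finset.univ : Finset Bool)).card =
      if s ∈ S then 1 else 2 := by
    intro s; split_ifs <;> simp
  simp only [h2]
  rw [Finset.prod_ite]
  simp only [Finset.prod_const_one, one_mul, Finset.prod_const]
  congr 1
  have h3 : (Finset.univ.filter fun s => s ∉ S) = Sᶜ := by ext; simp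
  rw [h3, Finset.card_compl, Fintype.card_fin]

/-! ### Moments of sign sums and balanced labels -/

/-- The sign attached to a label. -/
def sgn (b : Bool) : ℤ := if b then 1 else -1

theorem sum_flip {n : ℕ} (a : Fin n) (g : (Fin n → Bool) → ℤ) :
    ∑ X, g X = ∑ X, g (Function.update X a (!(X a))) := by
  refine (Fintype.sum_bijective (fun X : Fin n → Bool => Function.update X a (!(X a))) ?_ _ _
    (fun X => rfl)).symm
  apply Function.Involutive.bijective
  intro X
  simp

/-- Pairing each `X` with the sequence whose label at `a` is flipped gives a one-step recursion for
all moments. -/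
theorem sum_sgn_insert {n : ℕ} {A : Finset (Fin n)} {a : Fin n} (ha : a ∉ A) (q : ℤ → ℤ) :
    2 * ∑ X : Fin n → Bool, q (∑ c ∈ insert a A, sgn (X c)) =
      ∑ X : Fin n → Bool, (q (∑ c ∈ A, sgn (X c) + 1) + q (∑ c ∈ A, sgn (X c) - 1)) := by
  have h0 := sum_flip a fun X => q (∑ c ∈ insert a A, sgn (X c))
  rw [two_mul]
  nth_rewrite 2 [h0]
  rw [← Finset.sum_add_distrib]
  refine Finset.sum_congr rfl fun X _ => ?_
  have h1 : ∑ c ∈ A, sgn (Function.update X a (!(X a)) c) = ∑ c ∈ A, sgn (X c) := by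
    refine Finset.sum_congr rfl fun c hc => ?_
    rw [Function.update_of_ne]
    rintro rfl
    exact ha hc
  rw [Finset.sum_insert ha, Finset.sum_insert ha, h1, Function.update_self]
  cases X a <;> simp [sgn, add_comm, sub_eq_add_neg]

theorem second_moment {n : ℕ} (A : Finset (Fin n)) :
    ∑ X : Fin n → Bool, (∑ c ∈ A, sgn (X c)) ^ 2 = A.card * 2 ^ n := by
  classical
  induction A using Finset.induction_on with
  | empty => simp
  | insert a A ha ih =>
    have h := sum_sgn_insert ha (fun s => s ^ 2)
    have h2 : ∀ s : ℤ, (s + 1) ^ 2 + (s - 1) ^ 2 = 2 * s ^ 2 + 2 := by intro s; ring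
    simp only [h2, Finset.sum_add_distrib, ← Finset.mul_sum, ih, Finset.sum_const,
      Finset.card_univ, Fintype.card_fun, Fintype.card_bool, Fintype.card_fin] at h
    rw [Finset.card_insert_of_notMem ha]
    push_cast at h ⊢
    simp only [nsmul_eq_mul] at h
    push_cast at h
    linarith

/-- Adding a sign raises the average fourth power by `6 * A.card + 1`, which is at most the
increment of `3 * A.card ^ 2`. Second moments would not suffice: the union bound over prefixes would
then require `e` of larger order than `n`. -/
theorem fourth_moment {n : ℕ} (A : Finset (Fin n)) :
    ∑ X : Fin n → Bool, (∑ c ∈ A, sgn (X c)) ^ 4 ≤ 3 * A.card ^ 2 * 2 ^ n := by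
  classical
  induction A using Finset.induction_on with
  | empty => simp
  | insert a A ha ih =>
    have h := sum_sgn_insert ha (fun s => s ^ 4)
    have h2 : ∀ s : ℤ, (s + 1) ^ 4 + (s - 1) ^ 4 = 2 * s ^ 4 + 12 * s ^ 2 + 2 := by intro s; ring
    simp only [h2, Finset.sum_add_distrib, ← Finset.mul_sum, second_moment, Finset.sum_const,
      Finset.card_univ, Fintype.card_fun, Fintype.card_bool, Fintype.card_fin] at h
    rw [Finset.card_insert_of_notMem ha]
    push_cast at h ⊢
    simp only [nsmul_eq_mul] at h
    push_cast at h
    have : (0 : ℤ) < 2 ^ n := by positivity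
    nlinarith

/-- The number of `true` labels among the first `j`. -/
def cnt {n : ℕ} (X : Fin n → Bool) (j : ℕ) : ℕ :=
  (Finset.univ.filter fun c : Fin n => (c : ℕ) < j ∧ X c = true).card

/-- All prefixes of `X` are balanced up to the error `e`. -/
def Balanced {n : ℕ} (e : ℕ) (X : Fin n → Bool) : Prop :=
  ∀ j ≤ n, |2 * (cnt X j : ℤ) - j| ≤ e

theorem sum_sgn_prefix {n : ℕ} (X : Fin n → Bool) (j : ℕ) (hj : j ≤ n) :
    ∑ c ∈ Finset.univ.filter (fun c : Fin n => (c : ℕ) < j), sgn (X c) = 2 * (cnt X j : ℤ) - j := by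
  have h1 : (Finset.univ.filter fun c : Fin n => (c : ℕ) < j).card = j := by
    rw [Fin.card_filter_val_lt]; omega
  have h2 : ∀ c, sgn (X c) = 2 * (if X c = true then 1 else 0) - 1 := by
    intro c; cases X c <;> simp [sgn]
  simp only [h2, Finset.sum_sub_distrib, ← Finset.mul_sum, Finset.sum_const, h1, cnt,
    Finset.sum_boole, Finset.filter_filter, nsmul_eq_mul, mul_one]

theorem card_deviation_le {n : ℕ} (e j : ℕ) (hj : j ≤ n) :
    (e : ℤ) ^ 4 * (Finset.univ.filter fun X : Fin n → Bool =>
      (e : ℤ) < |2 * (cnt X j : ℤ) - j|).card ≤ 3 * n ^ 2 * 2 ^ n := by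
  have h := fourth_moment (Finset.univ.filter (fun c : Fin n => (c : ℕ) < j))
  have h1 : (Finset.univ.filter fun c : Fin n => (c : ℕ) < j).card = j := by
    rw [Fin.card_filter_val_lt]; omega
  simp only [sum_sgn_prefix _ j hj, h1] at h
  have h3 : (3 * (j : ℤ) ^ 2 * 2 ^ n) ≤ 3 * n ^ 2 * 2 ^ n := by gcongr
  refine le_trans ?_ (h.trans h3)
  rw [mul_comm, ← nsmul_eq_mul, ← Finset.sum_const]
  refine le_trans (Finset.sum_le_sum ?_) (Finset.sum_le_univ_sum_of_nonneg ?_)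
  · intro X hX
    rw [Finset.mem_filter] at hX
    rw [← Even.pow_abs (by decide : Even 4) (2 * (cnt X j : ℤ) - j)]
    exact pow_le_pow_left₀ (by positivity) hX.2.le 4
  · intro X
    positivity

-- Markov's inequality for the fourth power, followed by a union bound over the `n + 1` prefixes.
open Classical in
theorem card_not_balanced_le (n e : ℕ) :
    (e : ℤ) ^ 4 * (Finset.univ.filter fun X : Fin n → Bool => ¬ Balanced e X).card ≤
      (n + 1) * (3 * n ^ 2 * 2 ^ n) := by
  have hsub : (Finset.univ.filter fun X : Fin n → Bool => ¬ Balanced e X) ⊆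
      (Finset.range (n + 1)).biUnion fun j => Finset.univ.filter fun X : Fin n → Bool =>
        (e : ℤ) < |2 * (cnt X j : ℤ) - j| := by
    intro X hX
    simp only [Balanced, Finset.mem_filter, Finset.mem_univ, true_and, not_forall, not_le] at hX
    obtain ⟨j, hj, hX⟩ := hX
    simp only [Finset.mem_biUnion, Finset.mem_range, Finset.mem_filter, Finset.mem_univ, true_and]
    exact ⟨j, by omega, hX⟩
  have h1 := (Finset.card_le_card hsub).trans Finset.card_biUnion_le
  calc (e : ℤ) ^ 4 * (Finset.univ.filter fun X : Fin n → Bool => ¬ Balanced e X).card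
      ≤ (e : ℤ) ^ 4 * ((∑ j ∈ Finset.range (n + 1), (Finset.univ.filter fun X : Fin n → Bool =>
        (e : ℤ) < |2 * (cnt X j : ℤ) - j|).card : ℕ) : ℤ) := by gcongr
    _ ≤ ∑ j ∈ Finset.range (n + 1), (3 * (n : ℤ) ^ 2 * 2 ^ n) := by
        push_cast
        rw [Finset.mul_sum]
        refine Finset.sum_le_sum fun j hj => ?_
        rw [Finset.mem_range] at hj
        exact card_deviation_le e j (by omega)
    _ = _ := by simp

/-! ### Labels of a square permutation and the upper bound on their number -/

open Classical in
/-- The label of a column: `true` for the left-to-right or right-to-left minima. -/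
noncomputable def lowLabel {n : ℕ} (σ : Equiv.Perm (Fin n)) (c : Fin n) : Bool :=
  decide ((∀ j, j < c → σ c < σ j) ∨ (∀ j, c < j → σ c < σ j))

open Classical in
/-- The label of a row: `true` for the left-to-right minima or maxima. -/
noncomputable def leftLabel {n : ℕ} (σ : Equiv.Perm (Fin n)) (r : Fin n) : Bool :=
  decide ((∀ j, j < σ.symm r → σ j < r) ∨ (∀ j, j < σ.symm r → r < σ j))

/-- A left-to-right minimum cannot lie to the right of the lowest point, nor a right-to-left minimum
to its left. A point right of `z` may be both a right-to-left minimum and a left-to-right maximum,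
hence the conditional clause in the second case. -/
theorem label_classification {n : ℕ} {σ : Equiv.Perm (Fin n)} (hσ : σ ∈ Sq n) {z : Fin n}
    (hz : ∀ j, σ z ≤ σ j) (c : Fin n) :
    (c ≤ z ∧ lowLabel σ c = true ∧ leftLabel σ (σ c) = true ∧ ∀ j, j < c → σ c < σ j) ∨
    (z < c ∧ lowLabel σ c = true ∧ (∀ j, c < j → σ c < σ j) ∧
      (leftLabel σ (σ c) = true → ∀ j, j < c → σ j < σ c)) ∨
    (lowLabel σ c = false ∧ leftLabel σ (σ c) = true ∧ ∀ j, j < c → σ j < σ c) ∨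
    (lowLabel σ c = false ∧ leftLabel σ (σ c) = false ∧ ∀ j, c < j → σ j < σ c) := by
  simp only [lowLabel, leftLabel, Equiv.symm_apply_apply, decide_eq_true_eq, decide_eq_false_iff_not]
  have hc := hσ c
  unfold IsRecord at hc
  rcases lt_trichotomy c z with h | h | h
  · have h2 : ¬ ∀ j, c < j → σ c < σ j := fun hh => absurd (hh z h) (not_lt.2 (hz c))
    have h3 := h.le
    tauto
  · subst h
    have h2 : ∀ j, j < c → σ c < σ j := fun j hj =>
      lt_of_le_of_ne (hz j) (fun e => hj.ne (σ.injective e).symm)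
    have h3 := le_refl c
    tauto
  · have h2 : ¬ ∀ j, j < c → σ c < σ j := fun hh => absurd (hh z h) (not_lt.2 (hz c))
    generalize (∀ j, j < c → σ c < σ j) = q1 at *
    generalize (∀ j, c < j → σ c < σ j) = q2 at *
    generalize (∀ j, j < c → σ j < σ c) = q3 at *
    generalize (∀ j, c < j → σ j < σ c) = q4 at *
    clear hσ hz
    grind

/-- The rows are filled from the bottom upwards: once the lower rows are known, the labels leave a
single possible column for the next row. -/
theorem labels_injective {n : ℕ} {σ τ : Equiv.Perm (Fin n)} (hσ : σ ∈ Sq n) (hτ : τ ∈ Sq n)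
    {z : Fin n} (hz : ∀ j, σ z ≤ σ j) (hz' : ∀ j, τ z ≤ τ j)
    (hX : lowLabel σ = lowLabel τ) (hY : leftLabel σ = leftLabel τ) : σ = τ := by
  have key : ∀ k : ℕ, ∀ c : Fin n, (σ c : ℕ) = k → τ c = σ c := by
    intro k
    induction k using Nat.strong_induction_on with
    | _ k ih =>
      intro c hc
      by_contra hne
      have h1 : σ c < τ c := by
        by_contra hlt
        have hlt : τ c < σ c := lt_of_le_of_ne (not_lt.1 hlt) hne
        have := ih (τ c) (by omega) (σ.symm (τ c)) (by simp)
        rw [Equiv.apply_symm_apply] at this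
        have := τ.injective this
        rw [Equiv.symm_apply_eq] at this
        exact hne this
      -- The columns `c` and `d` compete for the same row. Each permutation places the losing column
      -- strictly higher, since all lower rows already agree.
      obtain ⟨d, hd⟩ : ∃ d, τ d = σ c := ⟨τ.symm (σ c), by simp⟩
      have h2 : σ c < σ d := by
        by_contra hlt
        rcases (not_lt.1 hlt).lt_or_eq with hlt | heq
        · have := ih (σ d) (by omega) d rfl
          rw [this] at hd
          exact hlt.ne hd
        · exact hne (by rw [← hd, σ.injective heq])
      have hcd : c ≠ d := by
        rintro rfl
        exact h2.ne rfl
      have a1 := label_classification hσ hz c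
      have a2 := label_classification hσ hz d
      have a3 := label_classification hτ hz' c
      have a4 := label_classification hτ hz' d
      -- Both permutations now share the labels of `c`, of `d` and of the contested row. The facts
      -- below record which record types would contradict the heights for each order of `c` and `d`;
      -- propositional reasoning finishes.
      rw [← hX, ← hY] at a3 a4
      rw [hd] at a4
      have b2 : (∀ j, j < d → σ d < σ j) → c < d → False := fun h hlt => by
        have := h c hlt; omega
      have b3 : (∀ j, j < c → τ c < τ j) → d < c → False := fun h hlt => by
        have := h d hlt; omega
      have b2' : (∀ j, d < j → σ d < σ j) → d < c → False := fun h hlt => by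
        have := h c hlt; omega
      have b3' : (∀ j, c < j → τ c < τ j) → c < d → False := fun h hlt => by
        have := h d hlt; omega
      have c1 : (∀ j, j < c → σ j < σ c) → d < c → False := fun h hlt => by
        have := h d hlt; omega
      have c1' : (∀ j, c < j → σ j < σ c) → c < d → False := fun h hlt => by
        have := h d hlt; omega
      have c2 : (∀ j, j < d → τ j < σ c) → c < d → False := fun h hlt => by
        have := h c hlt; omega
      have c2' : (∀ j, d < j → τ j < σ c) → d < c → False := fun h hlt => by
        have := h c hlt; omega
      have hlt : c < d ∨ d < c := lt_or_gt_of_ne hcd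
      clear ih hc hne h1 h2 hz hz' hσ hτ hX hY hd
      generalize (∀ j, j < d → σ d < σ j) = p1 at *
      generalize (∀ j, j < c → τ c < τ j) = p2 at *
      generalize (∀ j, d < j → σ d < σ j) = p3 at *
      generalize (∀ j, c < j → τ c < τ j) = p4 at *
      generalize (∀ j, j < c → σ j < σ c) = p5 at *
      generalize (∀ j, c < j → σ j < σ c) = p6 at *
      generalize (∀ j, j < d → τ j < σ c) = p7 at *
      generalize (∀ j, d < j → τ j < σ c) = p8 at *
      generalize (∀ j, j < c → σ c < σ j) = q1 at *
      generalize (∀ j, c < j → σ c < σ j) = q2 at *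
      generalize (∀ j, j < d → σ c < τ j) = q3 at *
      generalize (∀ j, d < j → σ c < τ j) = q4 at *
      generalize (∀ j, j < d → σ j < σ d) = q5 at *
      generalize (∀ j, d < j → σ j < σ d) = q6 at *
      generalize (∀ j, j < c → τ j < τ c) = q7 at *
      generalize (∀ j, c < j → τ j < τ c) = q8 at *
      generalize lowLabel σ c = xc at *
      generalize lowLabel σ d = xd at *
      generalize leftLabel σ (σ c) = y at *
      generalize leftLabel σ (σ d) = y1 at *
      generalize leftLabel σ (τ c) = y2 at *
      rcases a1 with a1 | a1 | a1 | a1 <;> rcases a4 with a4 | a4 | a4 | a4 <;> grind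
  ext c
  rw [key _ c rfl]

/-- The first and the last index. -/
def corners (n : ℕ) : Finset (Fin n) :=
  Finset.univ.filter fun c => (c : ℕ) = 0 ∨ (c : ℕ) + 1 = n

theorem card_corners {n : ℕ} (hn : 2 ≤ n) : (corners n).card = 2 := by
  have : corners n = {⟨0, by omega⟩, ⟨n - 1, by omega⟩} := by
    ext c
    simp only [corners, Finset.mem_filter, Finset.mem_univ, true_and, Finset.mem_insert,
      Finset.mem_singleton, Fin.ext_iff]
    omega
  rw [this, Finset.card_pair]
  simp only [ne_eq, Fin.ext_iff]
  omega

/-- Sequences of labels that are `true` on a given set. -/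
def pinned {n : ℕ} (S : Finset (Fin n)) : Finset (Fin n → Bool) :=
  Finset.univ.filter fun X => ∀ s ∈ S, X s = true

theorem mem_pinned {n : ℕ} {S : Finset (Fin n)} {X : Fin n → Bool} :
    X ∈ pinned S ↔ ∀ s ∈ S, X s = true := by
  simp [pinned]

open Classical in
theorem card_Sq_le {n : ℕ} (hn : 3 ≤ n) :
    (Finset.univ.filter fun σ : Equiv.Perm (Fin n) => σ ∈ Sq n).card ≤
      (n + 2) * 2 ^ (n - 3) * 2 ^ (n - 2) := by
  have h0 : 0 < n := by omega
  let f : Equiv.Perm (Fin n) → (_ : Fin n) × ((Fin n → Bool) × (Fin n → Bool)) :=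
    fun σ => ⟨σ.symm ⟨0, h0⟩, (lowLabel σ, leftLabel σ)⟩
  have hmin : ∀ (σ : Equiv.Perm (Fin n)) (j : Fin n), σ (σ.symm ⟨0, h0⟩) ≤ σ j := by
    intro σ j
    rw [Equiv.apply_symm_apply]
    exact Nat.zero_le _
  have h1 := Finset.card_le_card_of_injOn
    (s := Finset.univ.filter fun σ : Equiv.Perm (Fin n) => σ ∈ Sq n)
    (t := Finset.univ.sigma fun z => pinned (insert z (corners n)) ×ˢ pinned (corners n)) f ?_ ?_
  -- The two corner positions of `z` pin two labels of `X`, the other `n - 2` pin three: `2 * 2 ^ (n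
  -- - 2) + (n - 2) * 2 ^ (n - 3) = (n + 2) * 2 ^ (n - 3)`.
  · refine h1.trans (le_of_eq ?_)
    rw [Finset.card_sigma]
    have h2 : ∀ z : Fin n, (pinned (insert z (corners n)) ×ˢ pinned (corners n)).card =
        (if z ∈ corners n then 2 ^ (n - 2) else 2 ^ (n - 3)) * 2 ^ (n - 2) := by
      intro z
      rw [Finset.card_product, pinned, pinned, card_pinned _ (fun _ => true),
        card_pinned _ (fun _ => true), card_corners (by omega)]
      split_ifs with h
      · rw [Finset.insert_eq_of_mem h, card_corners (by omega)]
      · rw [Finset.card_insert_of_notMem h, card_corners (by omega)]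
    rw [Finset.sum_congr rfl fun z _ => h2 z, ← Finset.sum_mul, Finset.sum_ite]
    have h3 : (Finset.univ.filter fun z => z ∈ corners n).card = 2 := by
      rw [Finset.filter_univ_mem, card_corners (by omega)]
    have h4 : (Finset.univ.filter fun z => z ∉ corners n).card = n - 2 := by
      have : (Finset.univ.filter fun z => z ∉ corners n) = (corners n)ᶜ := by ext; simp
      rw [this, Finset.card_compl, card_corners (by omega), Fintype.card_fin]
    rw [Finset.sum_const, Finset.sum_const, h3, h4]
    congr 1
    obtain ⟨k, rfl⟩ := Nat.exists_eq_add_of_le hn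
    have e1 : 3 + k - 2 = k + 1 := by omega
    have e2 : 3 + k - 3 = k := by omega
    rw [e1, e2, pow_succ]
    simp only [smul_eq_mul]
    ring
  · intro σ hσ
    refine Finset.mem_coe.2 (Finset.mem_sigma.2 ⟨Finset.mem_univ _, ?_⟩)
    simp only [Finset.mem_product, mem_pinned, Finset.mem_insert, corners, Finset.mem_filter,
      forall_eq_or_imp, f, lowLabel, leftLabel, decide_eq_true_eq, Finset.mem_univ, true_and]
    refine ⟨⟨Or.inl fun j hj => ?_, fun c hc => ?_⟩, fun r hr => ?_⟩
    · exact lt_of_le_of_ne (hmin σ j) fun e => hj.ne (σ.injective e).symm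
    · rcases hc with hc | hc
      · left; intro j hj; omega
      · right; intro j hj; omega
    · rcases hr with hr | hr
      · right
        intro j hj
        have : r ≠ σ j := by rintro rfl; simp at hj
        omega
      · left
        intro j hj
        have : r ≠ σ j := by rintro rfl; simp at hj
        omega
  · intro σ hσ τ hτ h
    rw [Finset.mem_coe, Finset.mem_filter] at hσ hτ
    simp only [f, Sigma.mk.injEq, heq_eq_eq, Prod.mk.injEq] at h
    refine labels_injective hσ.2 hτ.2 (hmin σ) ?_ h.2.1 h.2.2
    rw [h.1]
    exact hmin τ

/-! ### Building a permutation from labels by a clockwise walk -/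

/-- The order in which the columns are visited: first the low columns up to `z` from right to
left, then the high columns from left to right, then the other low columns from right to left. -/
def colKey {n : ℕ} (X : Fin n → Bool) (z c : Fin n) : ℤ :=
  if X c = true then (if c ≤ z then -(c : ℤ) else 4 * n - c) else n + c

/-- The order in which the rows are visited: first the left rows upwards, then the right rows
downwards. -/
def rowKey {n : ℕ} (Y : Fin n → Bool) (r : Fin n) : ℤ :=
  if Y r = true then r else 3 * n - r

theorem colKey_injective {n : ℕ} (X : Fin n → Bool) (z : Fin n) :
    Function.Injective (colKey X z) := by
  intro a b h
  unfold colKey at h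
  ext
  split_ifs at h <;> omega

theorem rowKey_injective {n : ℕ} (Y : Fin n → Bool) : Function.Injective (rowKey Y) := by
  intro a b h
  unfold rowKey at h
  ext
  split_ifs at h <;> omega

/-- The permutation matches the columns with the rows in the order of the visits. -/
def Matches {n : ℕ} (X Y : Fin n → Bool) (z : Fin n) (σ : Equiv.Perm (Fin n)) : Prop :=
  ∀ a b, colKey X z a < colKey X z b ↔ rowKey Y (σ a) < rowKey Y (σ b)

theorem exists_matches {n : ℕ} (X Y : Fin n → Bool) (z : Fin n) : ∃ σ, Matches X Y z σ :=
  exists_perm_of_keys _ _ (colKey_injective X z) (rowKey_injective Y)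

theorem card_val_lt {n : ℕ} (c : Fin n) :
    (Finset.univ.filter fun d : Fin n => (d : ℕ) < c).card = c := by
  rw [Fin.card_filter_val_lt]; omega

section rank

variable {n : ℕ} (X Y : Fin n → Bool) (z : Fin n)

/-- The number of columns visited before `c`. -/
def colRank (c : Fin n) : ℕ := (Finset.univ.filter fun d => colKey X z d < colKey X z c).card

/-- The number of rows visited before `r`. -/
def rowRank (r : Fin n) : ℕ := (Finset.univ.filter fun d => rowKey Y d < rowKey Y r).card

variable {X Y z}

theorem Matches.rank_eq {σ : Equiv.Perm (Fin n)} (h : Matches X Y z σ) (c : Fin n) :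
    colRank X z c = rowRank Y (σ c) := by
  unfold colRank rowRank
  refine Finset.card_nbij' σ σ.symm ?_ ?_ ?_ ?_
  · intro a ha
    simpa [h a c] using ha
  · intro a ha
    simpa [h (σ.symm a) c] using ha
  · intro a _; simp
  · intro a _; simp

theorem rowRank_left {r : Fin n} (hr : Y r = true) : rowRank Y r = cnt Y r := by
  unfold rowRank cnt
  congr 1
  ext d
  simp only [rowKey, hr, Finset.mem_filter, Finset.mem_univ, true_and, if_true]
  cases hd : Y d <;> simp <;> omega

/-- The rows not visited before `r` are the right rows up to `r` inclusive, `r + 1 - cnt Y (r + 1)`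
in number. This and the column ranks are stated additively and checked indicator by indicator. -/
theorem rowRank_right {r : Fin n} (hr : Y r = false) : rowRank Y r + r + 1 = n + cnt Y (r + 1) := by
  have key : rowRank Y r + (Finset.univ.filter fun d : Fin n => (d : ℕ) < r + 1).card =
      ∑ d : Fin n, 1 + cnt Y (r + 1) := by
    unfold rowRank cnt
    simp only [Finset.card_filter, ← Finset.sum_add_distrib]
    refine Finset.sum_congr rfl fun d _ => ?_
    simp only [rowKey, hr]
    cases hd : Y d <;>
      simp only [reduceCtorEq, if_true, if_false, and_true, and_false] <;> split_ifs <;> omega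
  rw [Fin.card_filter_val_lt] at key
  simp only [Finset.sum_const, Finset.card_univ, Fintype.card_fin, smul_eq_mul, mul_one] at key
  omega

theorem colRank_low_left {c : Fin n} (hc : X c = true) (hz : c ≤ z) :
    colRank X z c + cnt X (c + 1) = cnt X (z + 1) := by
  unfold colRank cnt
  simp only [Finset.card_filter, ← Finset.sum_add_distrib]
  refine Finset.sum_congr rfl fun d _ => ?_
  simp only [colKey, hc, hz]
  cases hd : X d <;>
    simp only [reduceCtorEq, if_true, if_false, and_true, and_false] <;> split_ifs <;> omega

theorem colRank_high {c : Fin n} (hc : X c = false) :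
    colRank X z c + cnt X c = cnt X (z + 1) + c := by
  have key : colRank X z c + cnt X c =
      cnt X (z + 1) + (Finset.univ.filter fun d : Fin n => (d : ℕ) < c).card := by
    unfold colRank cnt
    simp only [Finset.card_filter, ← Finset.sum_add_distrib]
    refine Finset.sum_congr rfl fun d _ => ?_
    simp only [colKey, hc]
    cases hd : X d <;>
      simp only [reduceCtorEq, if_true, if_false, and_true, and_false] <;> split_ifs <;> omega
  rwa [card_val_lt] at key

theorem colRank_low_right {c : Fin n} (hc : X c = true) (hz : z < c) :
    colRank X z c + cnt X (c + 1) = cnt X (z + 1) + n := by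
  have key : colRank X z c + cnt X (c + 1) = cnt X (z + 1) + ∑ d : Fin n, 1 := by
    unfold colRank cnt
    simp only [Finset.card_filter, ← Finset.sum_add_distrib]
    refine Finset.sum_congr rfl fun d _ => ?_
    simp only [colKey, hc, not_le.2 hz]
    cases hd : X d <;>
      simp only [reduceCtorEq, if_true, if_false, and_true, and_false] <;> split_ifs <;> omega
  simpa using key

end rank

/-! ### Balanced labels give square permutations, injectively -/

/-- Balanced label sequences, pinned at the corners and at the bottom column `z`, which is far
from the corners. -/
structure Good {n : ℕ} (e : ℕ) (X Y : Fin n → Bool) (z : Fin n) : Prop where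
  balancedX : Balanced e X
  balancedY : Balanced e Y
  pinnedX : X ∈ pinned (insert z (corners n))
  pinnedY : Y ∈ pinned (corners n)
  le_z : 8 * e < z
  z_le : z + 8 * e + 1 < n

section good

variable {n e : ℕ} {X Y : Fin n → Bool} {z : Fin n} {σ : Equiv.Perm (Fin n)}

/-- The ranks of `c` and `σ c` agree, and `cnt` of a prefix of length `j` is `j / 2` up to `e / 2`.
Two prefixes of `X` and one of `Y` enter, so doubling gives the error `3 * e`. The margin on `z`
excludes a low column on the wrong side of its row. -/
theorem Good.heights (hg : Good e X Y z) (hσ : Matches X Y z σ) (c : Fin n) :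
    (X c = true ∧ c ≤ z ∧ Y (σ c) = true ∧ |((σ c : ℕ) : ℤ) - (z - c)| ≤ 3 * e) ∨
    (X c = true ∧ z < c ∧ Y (σ c) = false ∧ |((σ c : ℕ) : ℤ) - (c - z - 1)| ≤ 3 * e) ∨
    (X c = false ∧ Y (σ c) = true ∧ |((σ c : ℕ) : ℤ) - (z + 1 + c)| ≤ 3 * e) ∨
    (X c = false ∧ Y (σ c) = false ∧ |((σ c : ℕ) : ℤ) - (2 * n - 2 - z - c)| ≤ 3 * e) := by
  have hr := hσ.rank_eq c
  have x1 := hg.balancedX (c + 1) (by omega)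
  have x2 := hg.balancedX c (by omega)
  have x3 := hg.balancedX (z + 1) (by omega)
  have y1 := hg.balancedY (σ c + 1) (by omega)
  have y2 := hg.balancedY (σ c) (by omega)
  have hz1 := hg.le_z
  have hz2 := hg.z_le
  simp only [abs_le] at *
  have hc := c.isLt
  have hsc := (σ c).isLt
  cases hX : X c <;> cases hY : Y (σ c)
  · have h1 := colRank_high (z := z) hX
    have h2 := rowRank_right hY
    simp only [reduceCtorEq, false_and, true_and, false_or]
    push_cast at *
    omega
  · have h1 := colRank_high (z := z) hX
    have h2 := rowRank_left hY
    simp only [reduceCtorEq, false_and, true_and, false_or, or_false]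
    push_cast at *
    omega
  · have h2 := rowRank_right hY
    simp only [reduceCtorEq, false_and, true_and, false_or, or_false, and_false]
    rcases le_or_gt c z with h | h
    · have h1 := colRank_low_left hX h
      push_cast at *
      omega
    · have h1 := colRank_low_right hX h
      push_cast at *
      refine ⟨h, ?_⟩
      omega
  · have h2 := rowRank_left hY
    simp only [reduceCtorEq, false_and, true_and, and_false, or_false]
    rcases le_or_gt c z with h | h
    · have h1 := colRank_low_left hX h
      push_cast at *
      refine ⟨h, ?_⟩
      omega
    · have h1 := colRank_low_right hX h
      push_cast at *
      omega

/-- Points on the same row side are compared through the visiting order, which is exact even near a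
corner of the rectangle. Points on opposite row sides are compared through their approximate heights
where the order does not decide. The three lemmas that follow rest on the same split. -/
theorem Good.low_left (hg : Good e X Y z) (hσ : Matches X Y z σ) {c : Fin n}
    (hc : X c = true) (hcz : c ≤ z) (j : Fin n) (hj : j < c) : σ c < σ j := by
  have h1 := hg.heights hσ c
  have h2 := hg.heights hσ j
  have hk := hσ c j
  have hz1 := hg.le_z
  have hz2 := hg.z_le
  simp only [hc, not_lt.2 hcz, hcz, reduceCtorEq, false_and, true_and, and_false, or_false,
    abs_le] at h1
  have hc1 := h1.1
  simp only [abs_le] at h2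
  rcases h2 with ⟨b1, b2, b3, b4⟩ | ⟨b1, b2, b3, b4⟩ | ⟨b1, b3, b4⟩ | ⟨b1, b3, b4⟩ <;>
    simp only [colKey, rowKey, hc, hcz, hc1, b1, b3, reduceCtorEq, if_true, if_false] at hk <;>
    (try split_ifs at hk) <;> omega

theorem Good.low_right (hg : Good e X Y z) (hσ : Matches X Y z σ) {c : Fin n}
    (hc : X c = true) (hcz : z < c) (j : Fin n) (hj : c < j) : σ c < σ j := by
  have h1 := hg.heights hσ c
  have h2 := hg.heights hσ j
  have hk := hσ j c
  have hz1 := hg.le_z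
  have hz2 := hg.z_le
  simp only [hc, not_le.2 hcz, hcz, reduceCtorEq, false_and, true_and, and_false, or_false, false_or,
    abs_le] at h1
  have hc1 := h1.1
  simp only [abs_le] at h2
  rcases h2 with ⟨b1, b2, b3, b4⟩ | ⟨b1, b2, b3, b4⟩ | ⟨b1, b3, b4⟩ | ⟨b1, b3, b4⟩ <;>
    simp only [colKey, rowKey, hc, hc1, b1, b3, reduceCtorEq, if_true, if_false] at hk <;>
    (try split_ifs at hk) <;> omega

theorem Good.high_left (hg : Good e X Y z) (hσ : Matches X Y z σ) {c : Fin n}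
    (hc : X c = false) (hcz : Y (σ c) = true) (j : Fin n) (hj : j < c) : σ j < σ c := by
  have h1 := hg.heights hσ c
  have h2 := hg.heights hσ j
  have hk := hσ j c
  have hz1 := hg.le_z
  have hz2 := hg.z_le
  simp only [hc, hcz, reduceCtorEq, false_and, true_and, and_false, or_false, false_or,
    abs_le] at h1
  have hc1 := h1.1
  simp only [abs_le] at h2
  rcases h2 with ⟨b1, b2, b3, b4⟩ | ⟨b1, b2, b3, b4⟩ | ⟨b1, b3, b4⟩ | ⟨b1, b3, b4⟩ <;>
    simp only [colKey, rowKey, hc, hcz, b1, b3, reduceCtorEq, if_true, if_false] at hk <;>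
    (try split_ifs at hk) <;> omega

theorem Good.high_right (hg : Good e X Y z) (hσ : Matches X Y z σ) {c : Fin n}
    (hc : X c = false) (hcz : Y (σ c) = false) (j : Fin n) (hj : c < j) : σ j < σ c := by
  have h1 := hg.heights hσ c
  have h2 := hg.heights hσ j
  have hk := hσ c j
  have hz1 := hg.le_z
  have hz2 := hg.z_le
  simp only [hc, hcz, reduceCtorEq, false_and, true_and, and_false, false_or,
    abs_le] at h1
  have hc1 := h1.1
  simp only [abs_le] at h2
  rcases h2 with ⟨b1, b2, b3, b4⟩ | ⟨b1, b2, b3, b4⟩ | ⟨b1, b3, b4⟩ | ⟨b1, b3, b4⟩ <;>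
    simp only [colKey, rowKey, hc, hcz, b1, b3, reduceCtorEq, if_true, if_false] at hk <;>
    (try split_ifs at hk) <;> omega

theorem Good.mem_Sq (hg : Good e X Y z) (hσ : Matches X Y z σ) : σ ∈ Sq n := by
  intro c
  rcases hg.heights hσ c with h | h | h | h
  · exact Or.inr (Or.inl (hg.low_left hσ h.1 h.2.1))
  · exact Or.inr (Or.inr (Or.inr (hg.low_right hσ h.1 h.2.1)))
  · exact Or.inl (hg.high_left hσ h.1 h.2.1)
  · exact Or.inr (Or.inr (Or.inl (hg.high_right hσ h.1 h.2.1)))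

/-- Both `z` and the bottom row come first in their visiting orders, because their labels are
pinned. -/
theorem Good.apply_z (hg : Good e X Y z) (hσ : Matches X Y z σ) : ((σ z : Fin n) : ℕ) = 0 := by
  by_contra hne
  let r0 : Fin n := ⟨0, z.pos⟩
  have hY : Y r0 = true := mem_pinned.1 hg.pinnedY r0 (by simp [corners, r0])
  have hX : X z = true := mem_pinned.1 hg.pinnedX z (by simp)
  have hk := hσ (σ.symm r0) z
  have h1 : rowKey Y r0 < rowKey Y (σ z) := by
    simp only [rowKey, hY, if_true, r0]
    split_ifs <;> omega
  rw [Equiv.apply_symm_apply] at hk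
  have h2 := hk.2 h1
  simp only [colKey, hX, if_true, le_refl] at h2
  split_ifs at h2 <;> omega

variable {X' Y' : Fin n → Bool} {z' : Fin n}

/-- If a column were low for one labelling and high for the other, its point would be a minimum and
a maximum from the same side, impossible off the pinned corners, or the two approximate heights
would clash. -/
theorem Good.low_of_low (hg : Good e X Y z) (hg' : Good e X' Y' z) (hσ : Matches X Y z σ)
    (hσ' : Matches X' Y' z σ) {c : Fin n} (hc : X c = true) : X' c = true := by
  by_contra hc'
  rw [Bool.not_eq_true] at hc'
  have hz1 := hg.le_z
  have hz2 := hg.z_le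
  have hn := z.pos
  have hcor : ¬ ((c : ℕ) = 0 ∨ (c : ℕ) + 1 = n) := by
    intro hh
    have := mem_pinned.1 hg'.pinnedX c (by simp [corners, hh])
    simp [this] at hc'
  have h1 := hg.heights hσ c
  have h2 := hg'.heights hσ' c
  simp only [hc, hc', reduceCtorEq, false_and, true_and, or_false, false_or, abs_le] at h1 h2
  rcases h1 with h1 | h1 <;> rcases h2 with h2 | h2
  · have a1 := hg.low_left hσ hc h1.1 ⟨0, hn⟩ (by rw [Fin.lt_def]; simp only; omega)
    have a2 := hg'.high_left hσ' hc' h2.1 ⟨0, hn⟩ (by rw [Fin.lt_def]; simp only; omega)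
    exact lt_asymm a1 a2
  · omega
  · omega
  · have a1 := hg.low_right hσ hc h1.1 ⟨n - 1, by omega⟩ (by rw [Fin.lt_def]; simp only; omega)
    have a2 := hg'.high_right hσ' hc' h2.1 ⟨n - 1, by omega⟩ (by rw [Fin.lt_def]; simp only; omega)
    exact lt_asymm a1 a2

/-- The side of a low column relative to `z` fixes the label of its row, so a conflict needs a high
column. Its point would then be a maximum from both sides, hence in the top row, which is pinned. -/
theorem Good.left_of_left (hg : Good e X Y z) (hg' : Good e X Y' z) (hσ : Matches X Y z σ)
    (hσ' : Matches X Y' z σ) {r : Fin n} (hr : Y r = true) : Y' r = true := by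
  by_contra hr'
  rw [Bool.not_eq_true] at hr'
  obtain ⟨c, rfl⟩ := σ.surjective r
  have h1 := hg.heights hσ c
  have h2 := hg'.heights hσ' c
  simp only [hr, hr', reduceCtorEq, false_and, true_and, or_false, false_or, and_false] at h1 h2
  have hc : X c = false := by
    rcases h1 with h1 | h1
    · rcases h2 with h2 | h2
      · exact absurd h2.2.1 (not_lt.2 h1.2.1)
      · exact h2.1
    · exact h1.1
  have a1 := hg.high_left hσ hc hr
  have a2 := hg'.high_right hσ' hc hr'
  have hcor : (σ c : ℕ) + 1 ≠ n := by
    intro hh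
    have := mem_pinned.1 hg'.pinnedY (σ c) (by simp [corners, hh])
    simp [this] at hr'
  obtain ⟨d, hd⟩ := σ.surjective ⟨σ c + 1, by omega⟩
  have hlt : σ c < σ d := by rw [hd, Fin.lt_def]; simp
  rcases lt_trichotomy c d with h | h | h
  · exact lt_asymm hlt (a2 d h)
  · exact hlt.ne (by rw [h])
  · exact lt_asymm hlt (a1 d h)

theorem Good.unique (hg : Good e X Y z) (hg' : Good e X' Y' z') (hσ : Matches X Y z σ)
    (hσ' : Matches X' Y' z' σ) : z = z' ∧ X = X' ∧ Y = Y' := by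
  have hz : z = z' := by
    apply σ.injective
    ext
    rw [hg.apply_z hσ, hg'.apply_z hσ']
  subst hz
  have hX : X = X' := by
    funext c
    rw [Bool.eq_iff_iff]
    exact ⟨hg.low_of_low hg' hσ hσ', hg'.low_of_low hg hσ' hσ⟩
  subst hX
  refine ⟨rfl, rfl, ?_⟩
  funext r
  rw [Bool.eq_iff_iff]
  exact ⟨hg.left_of_left hg' hσ hσ', hg'.left_of_left hg hσ' hσ⟩

end good

/-! ### The pattern in a window around the root -/

/-- The column in position `a` of the window of radius `h` around `i`. -/
def windowCol {n h : ℕ} (i : Fin n) (h1 : h ≤ i) (h2 : i + h < n) (a : Fin (2 * h + 1)) : Fin n :=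
  ⟨i - h + a, by omega⟩

theorem restrict_ofPerm_eq {n h : ℕ} (σ : Equiv.Perm (Fin n)) (i : Fin n) (h1 : h ≤ i)
    (h2 : i + h < n) (π : Equiv.Perm (Fin (2 * h + 1))) (hh : h < 2 * h + 1)
    (H : ∀ a b, π a < π b → σ (windowCol i h1 h2 a) < σ (windowCol i h1 h2 b)) :
    restrict h (ofPerm σ i) = ofPerm π ⟨h, hh⟩ := by
  have H' : ∀ a b, σ (windowCol i h1 h2 a) ≤ σ (windowCol i h1 h2 b) ↔ π a ≤ π b := by
    intro a b
    constructor
    · intro hle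
      by_contra hlt
      exact absurd (H b a (not_le.1 hlt)) (not_lt.2 hle)
    · intro hle
      rcases hle.lt_or_eq with hlt | heq
      · exact (H a b hlt).le
      · rw [π.injective heq]
  ext l m
  · simp only [restrict, ofPerm, Set.mem_inter_iff, Set.mem_ofPred_eq, Set.mem_Icc]
    constructor
    · rintro ⟨⟨a, ha⟩, hl⟩
      exact ⟨⟨(l + h).toNat, by omega⟩, by simp only; omega⟩
    · rintro ⟨a, ha⟩
      have := a.isLt
      exact ⟨⟨⟨(l + i).toNat, by omega⟩, by simp only; omega⟩, by omega⟩
  · simp only [restrict, ofPerm, Set.mem_Icc]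
    constructor
    · rintro ⟨hl, hm, a, b, ha, hb, hab⟩
      refine ⟨⟨(l + h).toNat, by omega⟩, ⟨(m + h).toNat, by omega⟩, by simp only; omega,
        by simp only; omega, ?_⟩
      rw [← H']
      convert hab using 2 <;> (ext; simp only [windowCol]; omega)
    · rintro ⟨a, b, ha, hb, hab⟩
      have := a.isLt
      have := b.isLt
      refine ⟨by omega, by omega, windowCol i h1 h2 a, windowCol i h1 h2 b, ?_, ?_, (H' a b).2 hab⟩
      · simp only [windowCol]; omega
      · simp only [windowCol]; omega

theorem ofPerm_injective {n : ℕ} (i : Fin n) :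
    Function.Injective fun σ : Equiv.Perm (Fin n) => ofPerm σ i := by
  intro σ τ h
  have key : ∀ a b, σ a ≤ σ b → τ a ≤ τ b := by
    intro a b hab
    have h3 : (ofPerm σ i).le ((a : ℤ) - i) ((b : ℤ) - i) :=
      ⟨a, b, by omega, by omega, hab⟩
    simp only at h
    rw [h] at h3
    obtain ⟨a', b', ha, hb, hab'⟩ := h3
    have e1 : a' = a := by ext; omega
    have e2 : b' = b := by ext; omega
    rwa [e1, e2] at hab'
  refine perm_ext_of_lt σ τ fun a b hab => ?_
  refine lt_of_le_of_ne (key a b hab.le) fun e => ?_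
  rw [τ.injective e] at hab
  exact lt_irrefl _ hab

/-- The pairs of a bottom column `z` and a root `i` for which the window around `i` has the given
shape, with margin `m`. -/
def Region {n : ℕ} (m : ℕ) (j : Shape) (z i : Fin n) : Prop :=
  (m < z ∧ z + m + 1 < n ∧ m < i ∧ i + m + 1 < n) ∧
    match j with
    | .one => z + m < (i : ℕ) ∧ (i : ℕ) + z + m + 1 < n
    | .two => i + m < (z : ℕ) ∧ (i : ℕ) + z + m + 1 < n
    | .three => z + m < (i : ℕ) ∧ n + m < (i : ℕ) + z + 1
    | .four => i + m < (z : ℕ) ∧ n + m < (i : ℕ) + z + 1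

section window

variable {n e h : ℕ} {X Y : Fin n → Bool} {z i : Fin n} {σ : Equiv.Perm (Fin n)}

/-- The margin `8 * e` exceeds the window radius plus the height errors, so the window meets neither
`z` nor the turning zone near the top. Low points lie below high ones by their heights, and each
branch is monotone by its record property. -/
theorem Good.window (hg : Good e X Y z) (hσ : Matches X Y z σ) (he : h ≤ e) (h1 : h ≤ i)
    (h2 : i + h < n) {j : Shape} (hj : Region (8 * e) j z i) {π : Equiv.Perm (Fin (2 * h + 1))}
    (hπ : IsPsi h j {a | X (windowCol i h1 h2 a) = true} π) (a b : Fin (2 * h + 1))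
    (hab : π a < π b) : σ (windowCol i h1 h2 a) < σ (windowCol i h1 h2 b) := by
  obtain ⟨hm, hj⟩ := hj
  obtain ⟨hsep, hπ⟩ := hπ
  have hva : (windowCol i h1 h2 a : ℕ) = i - h + a := rfl
  have hvb : (windowCol i h1 h2 b : ℕ) = i - h + b := rfl
  have ha := a.isLt
  have hb := b.isLt
  have hne : a ≠ b := by rintro rfl; exact lt_irrefl _ hab
  have hs := hsep b
  simp only [Set.mem_ofPred_eq, Set.mem_compl_iff] at hs
  have la := hg.low_left hσ (c := windowCol i h1 h2 a)
  have lb := hg.low_right hσ (c := windowCol i h1 h2 a)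
  have lc := hg.high_left hσ (c := windowCol i h1 h2 b)
  have ld := hg.high_right hσ (c := windowCol i h1 h2 b)
  have ha3 := hg.heights hσ (windowCol i h1 h2 a)
  have hb3 := hg.heights hσ (windowCol i h1 h2 b)
  have hlt : a < b ∨ b < a := lt_or_gt_of_ne hne
  have low : ∀ c : Fin (2 * h + 1), X (windowCol i h1 h2 c) = true ↔
      c ∈ {a | X (windowCol i h1 h2 a) = true} := fun c => Iff.rfl
  have high : ∀ c : Fin (2 * h + 1), X (windowCol i h1 h2 c) = false →
      c ∈ {a | X (windowCol i h1 h2 a) = true}ᶜ := fun c hc => by simp [hc]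
  have hsa := (σ (windowCol i h1 h2 a)).isLt
  have hsb := (σ (windowCol i h1 h2 b)).isLt
  cases hxa : X (windowCol i h1 h2 a) <;> cases hxb : X (windowCol i h1 h2 b)
  · simp only [hxa, hxb, reduceCtorEq, false_and, true_and, false_or, abs_le] at ha3 hb3
    have ma := high a hxa
    have mb := high b hxb
    cases j <;> simp only at hj hπ
    · have := hπ.2.lt_iff_lt ma mb
      exact lc hxb (by rcases hb3 with hb3 | hb3 <;> [exact hb3.1; omega]) _
        (by rw [Fin.lt_def]; omega)
    · have := hπ.2.lt_iff_lt ma mb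
      exact lc hxb (by rcases hb3 with hb3 | hb3 <;> [exact hb3.1; omega]) _
        (by rw [Fin.lt_def]; omega)
    · have := hπ.2.lt_iff_gt ma mb
      exact ld hxb (by rcases hb3 with hb3 | hb3 <;> [omega; exact hb3.1]) _
        (by rw [Fin.lt_def]; omega)
    · have := hπ.2.lt_iff_gt ma mb
      exact ld hxb (by rcases hb3 with hb3 | hb3 <;> [omega; exact hb3.1]) _
        (by rw [Fin.lt_def]; omega)
  · exact absurd hab (not_lt.2 (hs hxb a (by simp [hxa])).le)
  · simp only [hxa, hxb, reduceCtorEq, false_and, true_and, or_false, false_or, abs_le] at ha3 hb3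
    rw [Fin.lt_def]
    omega
  · have ma := (low a).1 hxa
    have mb := (low b).1 hxb
    cases j <;> simp only at hj hπ
    · have := hπ.1.lt_iff_lt ma mb
      exact lb hxa (by rw [Fin.lt_def]; omega) _ (by rw [Fin.lt_def]; omega)
    · have := hπ.1.lt_iff_gt ma mb
      exact la hxa (by rw [Fin.le_def]; omega) _ (by rw [Fin.lt_def]; omega)
    · have := hπ.1.lt_iff_lt ma mb
      exact lb hxa (by rw [Fin.lt_def]; omega) _ (by rw [Fin.lt_def]; omega)
    · have := hπ.1.lt_iff_gt ma mb
      exact la hxa (by rw [Fin.le_def]; omega) _ (by rw [Fin.lt_def]; omega)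

end window

/-! ### Counting the sets `D` that produce a given pattern -/

section psi

variable {h : ℕ} {π : Equiv.Perm (Fin (2 * h + 1))}

/-- The lower set of the `t` smallest values. -/
def lowSet (π : Equiv.Perm (Fin (2 * h + 1))) (t : ℕ) : Set (Fin (2 * h + 1)) := {a | (π a : ℕ) < t}

theorem mem_lowSet {t : ℕ} {a : Fin (2 * h + 1)} : a ∈ lowSet π t ↔ (π a : ℕ) < t := Iff.rfl

theorem mem_lowSet_compl {t : ℕ} {a : Fin (2 * h + 1)} :
    a ∈ (lowSet π t)ᶜ ↔ t ≤ (π a : ℕ) := by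
  rw [Set.mem_compl_iff, mem_lowSet, not_lt]

open Classical in
/-- The number of sets `D` with `ψ_h(j, D) = (π, h + 1)`. -/
noncomputable def psiCount (j : Shape) (π : Equiv.Perm (Fin (2 * h + 1))) : ℕ :=
  (Finset.univ.filter fun w : Fin (2 * h + 1) → Bool => IsPsi h j {a | w a = true} π).card

theorem IsPsi.eq_lowSet {j : Shape} {D : Set (Fin (2 * h + 1))} (hD : IsPsi h j D π) :
    ∃ t < 2 * h + 2, D = lowSet π t := by
  classical
  obtain ⟨hs, -⟩ := hD
  by_cases hne : ∃ b, b ∉ D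
  · obtain ⟨b, hb, hmin⟩ := Finset.exists_min_image (Finset.univ.filter fun b => b ∉ D)
      (fun b => (π b : ℕ)) (by obtain ⟨b, hb⟩ := hne; exact ⟨b, by simpa using hb⟩)
    simp only [Finset.mem_filter, Finset.mem_univ, true_and] at hb hmin
    refine ⟨π b, by omega, ?_⟩
    ext a
    rw [mem_lowSet]
    refine ⟨fun ha => hs a ha b hb, fun ha => ?_⟩
    by_contra hn
    have := hmin a hn
    omega
  · push Not at hne
    refine ⟨2 * h + 1, by omega, ?_⟩
    ext a
    simp only [hne a, mem_lowSet, true_iff]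
    omega

theorem lowSet_injOn : Set.InjOn (lowSet π) (Set.Iio (2 * h + 2)) := by
  intro s hs t ht hst
  simp only [Set.mem_Iio] at hs ht
  by_contra hne
  wlog hlt : s < t generalizing s t
  · exact this hst.symm ht hs (Ne.symm hne) (by omega)
  have : π.symm ⟨s, by omega⟩ ∈ lowSet π t := by simp [mem_lowSet, hlt]
  rw [← hst, mem_lowSet] at this
  simp at this

-- Since `D` lies below its complement it consists of the `t` smallest values, so counting `D`
-- amounts to counting thresholds `t` from 0 to `2 * h + 1`.
open Classical in
theorem psiCount_eq (j : Shape) : psiCount j π =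
    ((Finset.range (2 * h + 2)).filter fun t => IsPsi h j (lowSet π t) π).card := by
  unfold psiCount
  symm
  refine Finset.card_nbij (fun t a => decide (a ∈ lowSet π t)) ?_ ?_ ?_
  · intro t ht
    rw [Finset.mem_coe, Finset.mem_filter] at ht ⊢
    simpa using ht.2
  · intro s hs t ht hst
    simp only [Finset.coe_filter, Finset.mem_range, Set.mem_ofPred_eq] at hs ht
    refine lowSet_injOn (π := π) hs.1 ht.1 ?_
    ext a
    have := congrFun hst a
    simpa using this
  · intro w hw
    simp only [Finset.coe_filter, Finset.mem_univ, true_and, Set.mem_ofPred_eq] at hw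
    obtain ⟨t, ht, he⟩ := hw.eq_lowSet
    refine ⟨t, ?_, ?_⟩
    · simp only [Finset.coe_filter, Finset.mem_range, Set.mem_ofPred_eq]
      exact ⟨ht, he ▸ hw⟩
    · funext a
      simp only [← he, Set.mem_ofPred_eq]
      cases w a <;> simp

theorem isPsi_lowSet_iff {j : Shape} {t : ℕ} : IsPsi h j (lowSet π t) π ↔
    match j with
    | .one => StrictMonoOn π (lowSet π t) ∧ StrictMonoOn π (lowSet π t)ᶜ
    | .two => StrictAntiOn π (lowSet π t) ∧ StrictMonoOn π (lowSet π t)ᶜ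
    | .three => StrictMonoOn π (lowSet π t) ∧ StrictAntiOn π (lowSet π t)ᶜ
    | .four => StrictAntiOn π (lowSet π t) ∧ StrictAntiOn π (lowSet π t)ᶜ := by
  refine ⟨fun hh => hh.2, fun hh => ⟨fun a ha b hb => ?_, hh⟩⟩
  rw [mem_lowSet] at ha
  rw [mem_lowSet_compl] at hb
  omega

theorem exists_apply_eq {s : ℕ} (hs : s < 2 * h + 1) : ∃ a, (π a : ℕ) = s :=
  ⟨π.symm ⟨s, hs⟩, by simp⟩

theorem psiCount_one_of_strictMono (hπ : StrictMono π) : psiCount .one π = 2 * h + 2 := by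
  classical
  rw [psiCount_eq, Finset.filter_true_of_mem, Finset.card_range]
  intro t _
  exact isPsi_lowSet_iff.2 ⟨hπ.strictMonoOn _, hπ.strictMonoOn _⟩

theorem psiCount_four_of_strictAnti (hπ : StrictAnti π) : psiCount .four π = 2 * h + 2 := by
  classical
  rw [psiCount_eq, Finset.filter_true_of_mem, Finset.card_range]
  intro t _
  exact isPsi_lowSet_iff.2 ⟨hπ.strictAntiOn _, hπ.strictAntiOn _⟩

/-- If two thresholds `s < t` worked, the point of value `s` would belong to the upper set of `s`
and to the lower set of `t`. It would link the two increasing parts and make `π` increasing. -/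
theorem psiCount_one_le (hπ : ¬ StrictMono π) : psiCount .one π ≤ 1 := by
  classical
  rw [psiCount_eq, Finset.card_le_one]
  intro s hs t ht
  simp only [Finset.mem_filter, Finset.mem_range, isPsi_lowSet_iff] at hs ht
  by_contra hne
  wlog hlt : s < t generalizing s t
  · exact this t s ht hs (Ne.symm hne) (by omega)
  obtain ⟨c, hc⟩ := exists_apply_eq (π := π) (s := s) (by omega)
  apply hπ
  have key : ∀ a b, π a < π b → a < b := by
    intro a b hab
    by_cases hb : (π b : ℕ) < t
    · exact (ht.2.1.lt_iff_lt (a := a) (b := b) (mem_lowSet.2 (by omega)) hb).1 hab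
    · by_cases ha : s ≤ (π a : ℕ)
      · exact (hs.2.2.lt_iff_lt (mem_lowSet_compl.2 ha) (mem_lowSet_compl.2 (by omega))).1 hab
      · have h1 := (ht.2.1.lt_iff_lt (a := a) (b := c) (mem_lowSet.2 (by omega))
          (mem_lowSet.2 (by omega))).1 (by omega)
        have h2 := (hs.2.2.lt_iff_lt (a := c) (b := b) (mem_lowSet_compl.2 (by omega))
          (mem_lowSet_compl.2 (by omega))).1 (by omega)
        exact h1.trans h2
  intro a b hab
  by_contra hn
  rcases (not_lt.1 hn).lt_or_eq with hn | hn
  · exact lt_asymm hab (key b a hn)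
  · exact hab.ne (π.injective hn).symm

theorem psiCount_four_le (hπ : ¬ StrictAnti π) : psiCount .four π ≤ 1 := by
  classical
  rw [psiCount_eq, Finset.card_le_one]
  intro s hs t ht
  simp only [Finset.mem_filter, Finset.mem_range, isPsi_lowSet_iff] at hs ht
  by_contra hne
  wlog hlt : s < t generalizing s t
  · exact this t s ht hs (Ne.symm hne) (by omega)
  obtain ⟨c, hc⟩ := exists_apply_eq (π := π) (s := s) (by omega)
  apply hπ
  have key : ∀ a b, π a < π b → b < a := by
    intro a b hab
    by_cases hb : (π b : ℕ) < t
    · exact (ht.2.1.lt_iff_gt (a := a) (b := b) (mem_lowSet.2 (by omega)) hb).1 hab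
    · by_cases ha : s ≤ (π a : ℕ)
      · exact (hs.2.2.lt_iff_gt (mem_lowSet_compl.2 ha) (mem_lowSet_compl.2 (by omega))).1 hab
      · have h1 := (ht.2.1.lt_iff_gt (a := a) (b := c) (mem_lowSet.2 (by omega))
          (mem_lowSet.2 (by omega))).1 (by omega)
        have h2 := (hs.2.2.lt_iff_gt (a := c) (b := b) (mem_lowSet_compl.2 (by omega))
          (mem_lowSet_compl.2 (by omega))).1 (by omega)
        exact h2.trans h1
  intro a b hab
  by_contra hn
  rcases (not_lt.1 hn).lt_or_eq with hn | hn
  · exact lt_asymm hab (key a b hn)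
  · exact hab.ne (π.injective hn)

/-- Among three values two consecutive ones fall on the same side of the threshold. The condition `1
≤ h` provides the three values. -/
theorem psiCount_one_of_strictAnti (hh : 1 ≤ h) (hπ : StrictAnti π) : psiCount .one π = 0 := by
  classical
  rw [psiCount_eq, Finset.card_eq_zero, Finset.filter_eq_empty_iff]
  intro t _ ht
  rw [isPsi_lowSet_iff] at ht
  obtain ⟨x, hx⟩ := exists_apply_eq (π := π) (s := 0) (by omega)
  obtain ⟨y, hy⟩ := exists_apply_eq (π := π) (s := 1) (by omega)
  obtain ⟨v, hv⟩ := exists_apply_eq (π := π) (s := 2) (by omega)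
  have h1 : y < x := hπ.lt_iff_gt.1 (by omega)
  have h2 : v < y := hπ.lt_iff_gt.1 (by omega)
  by_cases h3 : 2 ≤ t
  · have := (ht.1.lt_iff_lt (a := x) (b := y) (mem_lowSet.2 (by omega))
      (mem_lowSet.2 (by omega))).1 (by omega)
    exact lt_asymm h1 this
  · have := (ht.2.lt_iff_lt (a := y) (b := v) (mem_lowSet_compl.2 (by omega))
      (mem_lowSet_compl.2 (by omega))).1 (by omega)
    exact lt_asymm h2 this

theorem psiCount_four_of_strictMono (hh : 1 ≤ h) (hπ : StrictMono π) : psiCount .four π = 0 := by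
  classical
  rw [psiCount_eq, Finset.card_eq_zero, Finset.filter_eq_empty_iff]
  intro t _ ht
  rw [isPsi_lowSet_iff] at ht
  obtain ⟨x, hx⟩ := exists_apply_eq (π := π) (s := 0) (by omega)
  obtain ⟨y, hy⟩ := exists_apply_eq (π := π) (s := 1) (by omega)
  obtain ⟨v, hv⟩ := exists_apply_eq (π := π) (s := 2) (by omega)
  have h1 : x < y := hπ.lt_iff_lt.1 (by omega)
  have h2 : y < v := hπ.lt_iff_lt.1 (by omega)
  by_cases h3 : 2 ≤ t
  · have := (ht.1.lt_iff_gt (a := x) (b := y) (mem_lowSet.2 (by omega))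
      (mem_lowSet.2 (by omega))).1 (by omega)
    exact lt_asymm h1 this
  · have := (ht.2.lt_iff_gt (a := y) (b := v) (mem_lowSet_compl.2 (by omega))
      (mem_lowSet_compl.2 (by omega))).1 (by omega)
    exact lt_asymm h2 this

theorem psiCount_pos_iff {j : Shape} : 0 < psiCount j π ↔ ∃ D, IsPsi h j D π := by
  classical
  unfold psiCount
  rw [Finset.card_pos]
  constructor
  · rintro ⟨w, hw⟩
    exact ⟨_, (Finset.mem_filter.1 hw).2⟩
  · rintro ⟨D, hD⟩
    exact ⟨fun a => decide (a ∈ D), by simpa using hD⟩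

/-- If all `t` that work are among `s` and `s + 1`, and these work together, then the count is
`0` or `2`. -/
theorem psiCount_eq_two {j : Shape} {s : ℕ} (hs : s < 2 * h + 1)
    (h1 : ∀ t < 2 * h + 2, IsPsi h j (lowSet π t) π → t = s ∨ t = s + 1)
    (h2 : IsPsi h j (lowSet π s) π ↔ IsPsi h j (lowSet π (s + 1)) π)
    (hpos : 0 < psiCount j π) : psiCount j π = 2 := by
  classical
  rw [psiCount_eq] at hpos ⊢
  have : ((Finset.range (2 * h + 2)).filter fun t => IsPsi h j (lowSet π t) π) = {s, s + 1} := by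
    obtain ⟨t, ht⟩ := Finset.card_pos.1 hpos
    simp only [Finset.mem_filter, Finset.mem_range] at ht
    have h4 : IsPsi h j (lowSet π s) π := by
      rcases h1 t ht.1 ht.2 with rfl | rfl
      · exact ht.2
      · exact h2.2 ht.2
    have h5 := h2.1 h4
    ext u
    simp only [Finset.mem_filter, Finset.mem_range, Finset.mem_insert, Finset.mem_singleton]
    constructor
    · rintro ⟨hu, hu'⟩
      exact h1 u hu hu'
    · rintro (rfl | rfl)
      · exact ⟨by omega, h4⟩
      · exact ⟨by omega, h5⟩
  rw [this, Finset.card_pair (by omega)]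

/-- The two branches open to the right, so the first column holds the largest low value or the
smallest high value. It can be moved freely between the two sides, and this is the only freedom.
Hence the factor 2 in `p`; shape three is the mirror image, with the last column. -/
theorem psiCount_two_eq (hpos : 0 < psiCount .two π) : psiCount .two π = 2 := by
  have hs := (π 0).isLt
  refine psiCount_eq_two (s := (π 0 : ℕ)) hs ?_ ?_ hpos
  · intro t ht hp
    rw [isPsi_lowSet_iff] at hp
    by_contra hne
    by_cases hlt : t < (π 0 : ℕ)
    · obtain ⟨c, hc⟩ := exists_apply_eq (π := π) (s := t) (by omega)
      have := (hp.2.lt_iff_lt (a := c) (b := 0) (mem_lowSet_compl.2 (by omega))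
        (mem_lowSet_compl.2 (by omega))).1 (by omega)
      exact absurd this (Fin.not_lt_zero _)
    · obtain ⟨c, hc⟩ := exists_apply_eq (π := π) (s := t - 1) (by omega)
      have := (hp.1.lt_iff_gt (a := 0) (b := c) (mem_lowSet.2 (by omega))
        (mem_lowSet.2 (by omega))).1 (by omega)
      exact absurd this (Fin.not_lt_zero _)
  · have h0 : ∀ a : Fin (2 * h + 1), (π a : ℕ) = π 0 → a = 0 := fun a ha =>
      π.injective (Fin.ext ha)
    have h0' : ∀ a : Fin (2 * h + 1), 0 ≤ a := Fin.zero_le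
    rw [isPsi_lowSet_iff, isPsi_lowSet_iff]
    simp only [StrictAntiOn, StrictMonoOn, mem_lowSet, mem_lowSet_compl]
    constructor
    · rintro ⟨hl, hu⟩
      refine ⟨fun a ha b hb hab => ?_, fun a ha b hb hab => hu (by omega) (by omega) hab⟩
      have hb0 : b ≠ 0 := by have := h0' a; omega
      have hb' : (π b : ℕ) < π 0 := by
        have := mt (h0 b) hb0; omega
      by_cases ha' : (π a : ℕ) = π 0
      · omega
      · exact hl (by omega) hb' hab
    · rintro ⟨hl, hu⟩
      refine ⟨fun a ha b hb hab => hl (by omega) (by omega) hab, fun a ha b hb hab => ?_⟩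
      have hb0 : b ≠ 0 := by have := h0' a; omega
      have hb' : (π 0 : ℕ) < π b := by
        have := mt (h0 b) hb0; omega
      by_cases ha' : (π a : ℕ) = π 0
      · omega
      · exact hu (by omega) hb' hab

theorem psiCount_three_eq (hpos : 0 < psiCount .three π) : psiCount .three π = 2 := by
  have hs := (π (Fin.last _)).isLt
  refine psiCount_eq_two (s := (π (Fin.last _) : ℕ)) hs ?_ ?_ hpos
  · intro t ht hp
    rw [isPsi_lowSet_iff] at hp
    by_contra hne
    by_cases hlt : t < (π (Fin.last _) : ℕ)
    · obtain ⟨c, hc⟩ := exists_apply_eq (π := π) (s := t) (by omega)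
      have := (hp.2.lt_iff_gt (a := c) (b := Fin.last _) (mem_lowSet_compl.2 (by omega))
        (mem_lowSet_compl.2 (by omega))).1 (by omega)
      exact absurd this (not_lt.2 (Fin.le_last _))
    · obtain ⟨c, hc⟩ := exists_apply_eq (π := π) (s := t - 1) (by omega)
      have := (hp.1.lt_iff_lt (a := Fin.last _) (b := c) (mem_lowSet.2 (by omega))
        (mem_lowSet.2 (by omega))).1 (by omega)
      exact absurd this (not_lt.2 (Fin.le_last _))
  · have h0 : ∀ a : Fin (2 * h + 1), (π a : ℕ) = π (Fin.last _) → a = Fin.last _ := fun a ha =>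
      π.injective (Fin.ext ha)
    have h0' : ∀ a : Fin (2 * h + 1), a ≤ Fin.last _ := Fin.le_last
    rw [isPsi_lowSet_iff, isPsi_lowSet_iff]
    simp only [StrictAntiOn, StrictMonoOn, mem_lowSet, mem_lowSet_compl]
    constructor
    · rintro ⟨hl, hu⟩
      refine ⟨fun a ha b hb hab => ?_, fun a ha b hb hab => hu (by omega) (by omega) hab⟩
      have hb0 : a ≠ Fin.last _ := (lt_of_lt_of_le hab (h0' b)).ne
      have hb' : (π a : ℕ) < π (Fin.last _) := by
        have := mt (h0 a) hb0; omega
      by_cases ha' : (π b : ℕ) = π (Fin.last _)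
      · omega
      · exact hl hb' (by omega) hab
    · rintro ⟨hl, hu⟩
      refine ⟨fun a ha b hb hab => hl (by omega) (by omega) hab, fun a ha b hb hab => ?_⟩
      have hb0 : a ≠ Fin.last _ := (lt_of_lt_of_le hab (h0' b)).ne
      have hb' : (π (Fin.last _) : ℕ) < π a := by
        have := mt (h0 a) hb0; omega
      by_cases ha' : (π b : ℕ) = π (Fin.last _)
      · omega
      · exact hu hb' (by omega) hab

theorem ind_eq {α : Type*} (A : Set α) (x : α) [Decidable (x ∈ A)] :
    ind A x = if x ∈ A then 1 else 0 := by
  by_cases hx : x ∈ A <;> simp [ind, hx]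

/-- The coefficients in `p` are the multiplicities of `π` as a value of `ψ_h`: at most 1 for each of
shapes one and four off the monotone case, 0 or 2 for shapes two and three, and `2 * h + 2` for a
monotone `π` under its own shape. -/
theorem p_eq (hh : 1 ≤ h) (π : Equiv.Perm (Fin (2 * h + 1))) :
    p h π = ((psiCount .one π + psiCount .two π + psiCount .three π + psiCount .four π : ℕ) : ℝ) /
      (4 * 2 ^ (2 * h + 1)) := by
  classical
  have h2 : 2 * ind (A₂ h) π = (psiCount .two π : ℝ) := by
    have m : π ∈ A₂ h ↔ 0 < psiCount .two π := psiCount_pos_iff.symm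
    simp only [ind_eq, m]
    split_ifs with hp
    · rw [psiCount_two_eq hp]; norm_num
    · rw [Nat.eq_zero_of_not_pos hp]; norm_num
  have h3 : 2 * ind (A₃ h) π = (psiCount .three π : ℝ) := by
    have m : π ∈ A₃ h ↔ 0 < psiCount .three π := psiCount_pos_iff.symm
    simp only [ind_eq, m]
    split_ifs with hp
    · rw [psiCount_three_eq hp]; norm_num
    · rw [Nat.eq_zero_of_not_pos hp]; norm_num
  have h14 : ind (A₁ h) π + ind (A₄ h) π + (((2 * h + 1 : ℕ) : ℝ) + 1) * ind (A₅ h ∪ A₆ h) π =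
      (psiCount .one π : ℝ) + psiCount .four π := by
    have m1 : π ∈ A₁ h ↔ ¬ (StrictMono π ∨ StrictAnti π) ∧ 0 < psiCount .one π :=
      and_congr_right fun _ => psiCount_pos_iff.symm
    have m4 : π ∈ A₄ h ↔ ¬ (StrictMono π ∨ StrictAnti π) ∧ 0 < psiCount .four π :=
      and_congr_right fun _ => psiCount_pos_iff.symm
    have m5 : π ∈ A₅ h ∪ A₆ h ↔ StrictMono π ∨ StrictAnti π := Iff.rfl
    simp only [ind_eq, m1, m4, m5]
    by_cases hm : StrictMono π
    · rw [psiCount_one_of_strictMono hm, psiCount_four_of_strictMono hh hm]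
      simp only [hm, true_or, not_true_eq_false, false_and, if_true, if_false]
      push_cast
      ring
    · by_cases ha : StrictAnti π
      · rw [psiCount_four_of_strictAnti ha, psiCount_one_of_strictAnti hh ha]
        simp only [ha, or_true, not_true_eq_false, false_and, if_true, if_false]
        push_cast
        ring
      · have b1 := psiCount_one_le hm
        have b4 := psiCount_four_le ha
        simp only [hm, ha, or_self, not_false_eq_true, true_and, if_false, mul_zero, add_zero]
        congr 1
        · split_ifs with hp
          · have : psiCount .one π = 1 := by omega
            rw [this]; norm_num
          · rw [Nat.eq_zero_of_not_pos hp]; norm_num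
        · split_ifs with hp
          · have : psiCount .four π = 1 := by omega
            rw [this]; norm_num
          · rw [Nat.eq_zero_of_not_pos hp]; norm_num
  have hpow : (2 : ℝ) ^ (-((2 * h + 1 : ℕ) : ℤ) - 2) = 1 / (4 * 2 ^ (2 * h + 1)) := by
    rw [zpow_sub₀ two_ne_zero, zpow_neg, zpow_natCast]
    norm_num
    ring
  rw [p, hpow, h2, h3]
  push_cast at h14 ⊢
  rw [div_mul_eq_mul_div, one_mul]
  congr 1
  linarith

end psi

/-! ### The limiting probabilities sum to 1 -/

/-- Each set `D` arises for exactly one permutation of each shape. -/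
theorem existsUnique_isPsi (h : ℕ) (j : Shape) (D : Set (Fin (2 * h + 1))) :
    ∃! π, IsPsi h j D π := by
  classical
  have key : ∀ f : Fin (2 * h + 1) → ℤ, Function.Injective f →
      ∃ π : Equiv.Perm (Fin (2 * h + 1)), ∀ a b, f a < f b ↔ π a < π b := by
    intro f hf
    obtain ⟨π, hπ⟩ := exists_perm_of_keys f (fun a => (a : ℤ)) hf
      (fun a b hab => by ext; simpa using hab)
    exact ⟨π, fun a b => (hπ a b).trans (by simp)⟩
  let s1 : ℤ := match j with | .one => 1 | .two => -1 | .three => 1 | .four => -1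
  let s2 : ℤ := match j with | .one => 1 | .two => 1 | .three => -1 | .four => -1
  have e1 : s1 = 1 ∨ s1 = -1 := by cases j <;> simp [s1]
  have e2 : s2 = 1 ∨ s2 = -1 := by cases j <;> simp [s2]
  -- The signs prescribe the directions on the two parts; the shift `6 * (2 * h + 1)` puts every key
  -- of the complement above every key of `D`.
  have hf : Function.Injective fun a : Fin (2 * h + 1) =>
      if a ∈ D then s1 * a else s2 * a + 6 * (2 * h + 1) := by
    intro a b hab
    simp only at hab
    have ha := a.isLt
    have hb := b.isLt
    ext
    rcases e1 with e1 | e1 <;> rcases e2 with e2 | e2 <;> rw [e1, e2] at hab <;>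
      split_ifs at hab <;> omega
  obtain ⟨π, hπ⟩ := key _ hf
  refine ⟨π, ⟨?_, ?_⟩, ?_⟩
  · intro a ha b hb
    rw [← hπ, if_pos ha, if_neg hb]
    have ha := a.isLt
    have hb := b.isLt
    rcases e1 with e1 | e1 <;> rcases e2 with e2 | e2 <;> rw [e1, e2] <;> omega
  · cases j <;> refine ⟨fun a ha b hb hab => ?_, fun a ha b hb hab => ?_⟩ <;> rw [← hπ]
    all_goals first
      | (rw [if_pos ha, if_pos hb]; simp only [s1]; omega)
      | (rw [if_neg ha, if_neg hb]; simp only [s2]; omega)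
  · intro τ hτ
    refine perm_ext_of_lt τ π fun a b hab => ?_
    have hne : a ≠ b := by rintro rfl; exact lt_irrefl _ hab
    obtain ⟨hs, hτ⟩ := hτ
    rw [← hπ]
    have hal := a.isLt
    have hbl := b.isLt
    by_cases ha : a ∈ D <;> by_cases hb : b ∈ D
    · rw [if_pos ha, if_pos hb]
      cases j <;> simp only [s1] at hτ ⊢
      · have := (hτ.1.lt_iff_lt ha hb).1 hab; omega
      · have := (hτ.1.lt_iff_gt ha hb).1 hab; omega
      · have := (hτ.1.lt_iff_lt ha hb).1 hab; omega
      · have := (hτ.1.lt_iff_gt ha hb).1 hab; omega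
    · rw [if_pos ha, if_neg hb]
      rcases e1 with e1 | e1 <;> rcases e2 with e2 | e2 <;> rw [e1, e2] <;> omega
    · exact absurd hab (not_lt.2 (hs b hb a ha).le)
    · rw [if_neg ha, if_neg hb]
      cases j <;> simp only [s2] at hτ ⊢
      · have := (hτ.2.lt_iff_lt ha hb).1 hab; omega
      · have := (hτ.2.lt_iff_lt ha hb).1 hab; omega
      · have := (hτ.2.lt_iff_gt ha hb).1 hab; omega
      · have := (hτ.2.lt_iff_gt ha hb).1 hab; omega

theorem sum_psiCount (h : ℕ) (j : Shape) :
    ∑ π : Equiv.Perm (Fin (2 * h + 1)), psiCount j π = 2 ^ (2 * h + 1) := by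
  classical
  unfold psiCount
  simp only [Finset.card_filter]
  rw [Finset.sum_comm]
  have : ∀ w : Fin (2 * h + 1) → Bool, (∑ π : Equiv.Perm (Fin (2 * h + 1)),
      if IsPsi h j {a | w a = true} π then 1 else 0) = 1 := by
    intro w
    obtain ⟨π, hπ, hu⟩ := existsUnique_isPsi h j {a | w a = true}
    rw [Finset.sum_boole, Nat.cast_id, Finset.card_eq_one]
    refine ⟨π, ?_⟩
    ext τ
    simp only [Finset.mem_filter, Finset.mem_univ, true_and, Finset.mem_singleton]
    exact ⟨hu τ, fun e => e ▸ hπ⟩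
  rw [Finset.sum_congr rfl fun w _ => this w]
  simp

theorem sum_p {h : ℕ} (hh : 1 ≤ h) : ∑ π : Equiv.Perm (Fin (2 * h + 1)), p h π = 1 := by
  simp only [p_eq hh]
  rw [← Finset.sum_div, ← Nat.cast_sum]
  simp only [Finset.sum_add_distrib, sum_psiCount]
  push_cast
  rw [div_eq_one_iff_eq (by positivity)]
  ring

/-! ### Sizes of the four triangular regions -/

section regions

open Classical in
/-- The pairs `(z, i)` in the region of shape `j` with margin `m`. -/
noncomputable def regionSet (n m : ℕ) (j : Shape) : Finset (Fin n × Fin n) :=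
  Finset.univ.filter fun q => Region m j q.1 q.2

theorem mem_regionSet {n m : ℕ} {j : Shape} {q : Fin n × Fin n} :
    q ∈ regionSet n m j ↔ Region m j q.1 q.2 := by
  simp [regionSet]

theorem card_regionSet_two (n m : ℕ) :
    (regionSet n m .two).card = (regionSet n m .one).card := by
  refine Finset.card_nbij' Prod.swap Prod.swap ?_ ?_ (fun _ _ => rfl) (fun _ _ => rfl)
  all_goals
    rintro ⟨z, i⟩ hq
    rw [Finset.mem_coe, mem_regionSet] at hq ⊢
    simp only [Region, Prod.swap] at hq ⊢
    omega

theorem card_regionSet_rev {n m : ℕ} {j j' : Shape}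
    (h : ∀ z i : Fin n, Region m j z i ↔ Region m j' z.rev i.rev) :
    (regionSet n m j).card = (regionSet n m j').card := by
  refine Finset.card_nbij' (fun q => (q.1.rev, q.2.rev)) (fun q => (q.1.rev, q.2.rev)) ?_ ?_
    (fun _ _ => by simp) (fun _ _ => by simp)
  · rintro ⟨z, i⟩ hq
    rw [Finset.mem_coe, mem_regionSet] at hq ⊢
    exact (h z i).1 hq
  · rintro ⟨z, i⟩ hq
    rw [Finset.mem_coe, mem_regionSet] at hq ⊢
    rw [h]
    simpa using hq

theorem card_regionSet_three (n m : ℕ) :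
    (regionSet n m .three).card = (regionSet n m .one).card := by
  rw [← card_regionSet_two]
  refine card_regionSet_rev fun z i => ?_
  simp only [Region, Fin.val_rev]
  omega

theorem card_regionSet_four (n m : ℕ) :
    (regionSet n m .four).card = (regionSet n m .one).card := by
  refine card_regionSet_rev fun z i => ?_
  simp only [Region, Fin.val_rev]
  omega

theorem card_strip_le (n k : ℕ) (f : Fin n → ℤ) :
    (Finset.univ.filter fun q : Fin n × Fin n => f q.1 ≤ q.2 ∧ (q.2 : ℤ) < f q.1 + k).card ≤
      n * k := by
  rw [Finset.card_filter, Fintype.sum_prod_type]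
  have : ∀ z : Fin n, (∑ i : Fin n, if f z ≤ i ∧ (i : ℤ) < f z + k then 1 else 0) ≤ k := by
    intro z
    rw [Finset.sum_boole, Nat.cast_id]
    have h1 : (Finset.Ico (f z) (f z + k)).card = k := by simp
    rw [← h1]
    refine Finset.card_le_card_of_injOn (fun i => (i : ℤ)) ?_ ?_
    · intro i hi
      simpa using hi
    · intro a _ b _ hab
      ext
      simpa using hab
  calc _ ≤ ∑ _z : Fin n, k := Finset.sum_le_sum fun z _ => this z
    _ = n * k := by simp

/-- The four regions have equal size by symmetry. What they miss is covered by two diagonal strips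
of width `2 * m + 1` and four border strips of width `m + 1`, at most `n * (8 * m + 6)` pairs. -/
theorem sq_le_card_regionSet (n m : ℕ) :
    n * n ≤ 4 * (regionSet n m .one).card + n * (8 * m + 8) := by
  classical
  let S : ℕ → (Fin n → ℤ) → Finset (Fin n × Fin n) := fun k f =>
    Finset.univ.filter fun q => f q.1 ≤ q.2 ∧ (q.2 : ℤ) < f q.1 + k
  have hS : ∀ k f, (S k f).card ≤ n * k := fun k f => card_strip_le n k f
  have hcov : (Finset.univ : Finset (Fin n × Fin n)) ⊆
      (regionSet n m .one ∪ regionSet n m .two ∪ regionSet n m .three ∪ regionSet n m .four) ∪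
      (S (2 * m + 1) (fun z => z - m) ∪ S (2 * m + 1) (fun z => n - 1 - z - m) ∪
        S (m + 1) (fun _ => 0) ∪ S (m + 1) (fun _ => n - m - 1) ∪
        (S (m + 1) (fun _ => 0)).image Prod.swap ∪
        (S (m + 1) (fun _ => n - m - 1)).image Prod.swap) := by
    rintro ⟨z, i⟩ -
    have hswap : ∀ T : Finset (Fin n × Fin n), (z, i) ∈ T.image Prod.swap ↔ (i, z) ∈ T := by
      intro T
      simp [Prod.swap]
    simp only [Finset.mem_union, mem_regionSet, hswap]
    simp only [S, Finset.mem_filter, Finset.mem_univ, true_and, Region]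
    have := z.isLt
    have := i.isLt
    push_cast
    omega
  have h1 := Finset.card_le_card hcov
  rw [Finset.card_univ, Fintype.card_prod, Fintype.card_fin] at h1
  have e1 := card_regionSet_two n m
  have e2 := card_regionSet_three n m
  have e3 := card_regionSet_four n m
  have u := fun s t : Finset (Fin n × Fin n) => Finset.card_union_le s t
  have c1 := hS (2 * m + 1) (fun z => z - m)
  have c2 := hS (2 * m + 1) (fun z => n - 1 - z - m)
  have c3 := hS (m + 1) (fun _ => 0)
  have c4 := hS (m + 1) (fun _ => n - m - 1)
  have i3 : ((S (m + 1) (fun _ => 0)).image Prod.swap).card ≤ _ := Finset.card_image_le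
  have i4 : ((S (m + 1) (fun _ => n - m - 1)).image Prod.swap).card ≤ _ := Finset.card_image_le
  have d : n * (8 * m + 8) = 2 * (n * (2 * m + 1)) + 4 * (n * (m + 1)) + 2 * n := by ring
  have t1 := (u _ _).trans' h1
  have t2 := u (regionSet n m .one ∪ regionSet n m .two ∪ regionSet n m .three) (regionSet n m .four)
  have t3 := u (regionSet n m .one ∪ regionSet n m .two) (regionSet n m .three)
  have t4 := u (regionSet n m .one) (regionSet n m .two)
  have t5 := u (S (2 * m + 1) (fun z => z - m) ∪ S (2 * m + 1) (fun z => n - 1 - z - m) ∪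
        S (m + 1) (fun _ => 0) ∪ S (m + 1) (fun _ => n - m - 1) ∪
        (S (m + 1) (fun _ => 0)).image Prod.swap) ((S (m + 1) (fun _ => n - m - 1)).image Prod.swap)
  have t6 := u (S (2 * m + 1) (fun z => z - m) ∪ S (2 * m + 1) (fun z => n - 1 - z - m) ∪
        S (m + 1) (fun _ => 0) ∪ S (m + 1) (fun _ => n - m - 1))
        ((S (m + 1) (fun _ => 0)).image Prod.swap)
  have t7 := u (S (2 * m + 1) (fun z => z - m) ∪ S (2 * m + 1) (fun z => n - 1 - z - m) ∪
        S (m + 1) (fun _ => 0)) (S (m + 1) (fun _ => n - m - 1))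
  have t8 := u (S (2 * m + 1) (fun z => z - m) ∪ S (2 * m + 1) (fun z => n - 1 - z - m))
    (S (m + 1) (fun _ => 0))
  have t9 := u (S (2 * m + 1) (fun z => z - m)) (S (2 * m + 1) (fun z => n - 1 - z - m))
  omega

end regions

/-! ### Lower bound on the number of rooted square permutations with a given pattern -/

/-- A permutation that matches the given labels. -/
noncomputable def build {n : ℕ} (X Y : Fin n → Bool) (z : Fin n) : Equiv.Perm (Fin n) :=
  (exists_matches X Y z).choose

theorem build_matches {n : ℕ} (X Y : Fin n → Bool) (z : Fin n) : Matches X Y z (build X Y z) :=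
  (exists_matches X Y z).choose_spec

/-- The event that the `h`-restriction around the root is `π`. -/
def patternEvent (n : ℕ) {h : ℕ} (π : Equiv.Perm (Fin (2 * h + 1))) :
    Set (Equiv.Perm (Fin n) × Fin n) :=
  {x | restrict h (ofPerm x.1 x.2) = ofPerm π ⟨h, by omega⟩}

section counting

variable {n e h : ℕ}

-- The region keeps the window away from `z` and the corners, so a choice of `D` fixes `2 * h + 1`
-- labels beyond the three pinned ones.
open Classical in
theorem card_pinned_window {z i : Fin n} (he : h ≤ e) (h1 : h ≤ i) (h2 : i + h < n) {j : Shape}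
    (hj : Region (8 * e) j z i) (π : Equiv.Perm (Fin (2 * h + 1))) :
    ((pinned (insert z (corners n))).filter fun X =>
      IsPsi h j {a | X (windowCol i h1 h2 a) = true} π).card =
        psiCount j π * 2 ^ (n - (3 + (2 * h + 1))) := by
  have hz : (i : ℕ) + h < z ∨ (z : ℕ) + h < i := by
    obtain ⟨hm, hj⟩ := hj
    cases j <;> simp only at hj <;> omega
  obtain ⟨hm, -⟩ := hj
  have hinj : Function.Injective (windowCol i h1 h2) := by
    intro a b hab
    simp only [windowCol, Fin.mk.injEq] at hab
    ext
    omega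
  let S : Finset (Fin n) := insert z (corners n) ∪ Finset.univ.image (windowCol i h1 h2)
  have hzc : z ∉ corners n := by
    simp only [corners, Finset.mem_filter, Finset.mem_univ, true_and]
    omega
  have hnot : ∀ a, windowCol i h1 h2 a ∉ insert z (corners n) := by
    intro a
    have ha := a.isLt
    simp only [Finset.mem_insert, corners, Finset.mem_filter, Finset.mem_univ, true_and,
      Fin.ext_iff, windowCol]
    omega
  have hS : S.card = 3 + (2 * h + 1) := by
    rw [Finset.card_union_of_disjoint, Finset.card_insert_of_notMem hzc, card_corners (by omega),
      Finset.card_image_of_injective _ hinj, Finset.card_univ, Fintype.card_fin]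
    rw [Finset.disjoint_right]
    intro c hc
    obtain ⟨a, -, rfl⟩ := Finset.mem_image.1 hc
    exact hnot a
  rw [Finset.card_eq_sum_card_fiberwise (f := fun X a => X (windowCol i h1 h2 a))
    (t := Finset.univ.filter fun w : Fin (2 * h + 1) → Bool => IsPsi h j {a | w a = true} π)]
  · unfold psiCount
    refine Finset.sum_const_nat fun w hw => ?_
    rw [Finset.mem_filter] at hw
    -- Prescribed labels: `w` on the window, `true` on the pinned columns.
    have hk := card_pinned S fun c =>
      if hc : ∃ a, windowCol i h1 h2 a = c then w hc.choose else true
    rw [hS] at hk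
    rw [← hk]
    congr 1
    ext X
    simp only [Finset.mem_filter, mem_pinned, Finset.mem_univ, true_and]
    have hval : ∀ a, (if hc : ∃ b, windowCol i h1 h2 b = windowCol i h1 h2 a then w hc.choose
        else true) = w a := by
      intro a
      have hc : ∃ b, windowCol i h1 h2 b = windowCol i h1 h2 a := ⟨a, rfl⟩
      rw [dif_pos hc]
      exact congrArg w (hinj hc.choose_spec)
    have hval' : ∀ c ∈ insert z (corners n), (if hc : ∃ b, windowCol i h1 h2 b = c then w hc.choose
        else true) = true := by
      intro c hc
      rw [dif_neg]
      rintro ⟨a, rfl⟩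
      exact hnot a hc
    constructor
    · rintro ⟨⟨hp, -⟩, hw'⟩ s hs
      rcases Finset.mem_union.1 hs with hs | hs
      · rw [hval' s hs, hp s hs]
      · obtain ⟨a, -, rfl⟩ := Finset.mem_image.1 hs
        rw [hval, ← hw']
    · intro hX
      have hw' : (fun a => X (windowCol i h1 h2 a)) = w := by
        funext a
        rw [hX _ (Finset.mem_union_right _ (Finset.mem_image_of_mem _ (Finset.mem_univ a))), hval]
      refine ⟨⟨fun s hs => ?_, ?_⟩, hw'⟩
      · rw [hX s (Finset.mem_union_left _ hs), hval' s hs]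
      · have := hw.2
        rw [← hw'] at this
        exact this
  · intro X hX
    rw [Finset.mem_coe, Finset.mem_filter] at hX ⊢
    exact ⟨Finset.mem_univ _, hX.2⟩

open Classical in
/-- The good pairs of label sequences that give the pattern `π` around `i`. -/
noncomputable def goodLabels (e : ℕ) (π : Equiv.Perm (Fin (2 * h + 1))) (z i : Fin n) :
    Finset ((Fin n → Bool) × (Fin n → Bool)) :=
  Finset.univ.filter fun q => Good e q.1 q.2 z ∧ (build q.1 q.2 z, i) ∈ patternEvent n π

open Classical in
/-- The number of label sequences that are not balanced. -/
noncomputable def badCount (n e : ℕ) : ℕ :=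
  (Finset.univ.filter fun X : Fin n → Bool => ¬ Balanced e X).card

theorem card_goodLabels_ge (he : h ≤ e) {z i : Fin n} {j : Shape}
    (hj : Region (8 * e) j z i) (π : Equiv.Perm (Fin (2 * h + 1))) :
    psiCount j π * 2 ^ (n - (3 + (2 * h + 1))) * 2 ^ (n - 2) ≤
      (goodLabels e π z i).card + 2 * (badCount n e * 2 ^ n) := by
  classical
  have hm := hj.1
  have h1 : h ≤ i := by omega
  have h2 : i + h < n := by omega
  rw [← card_pinned_window he h1 h2 hj π]
  have hY : (pinned (corners n)).card = 2 ^ (n - 2) := by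
    rw [pinned, card_pinned _ (fun _ => true), card_corners (by omega)]
  rw [← hY, ← Finset.card_product]
  let bad : Finset (Fin n → Bool) := Finset.univ.filter fun X => ¬ Balanced e X
  have hu : (bad ×ˢ (Finset.univ : Finset (Fin n → Bool))).card +
      ((Finset.univ : Finset (Fin n → Bool)) ×ˢ bad).card = 2 * (badCount n e * 2 ^ n) := by
    rw [Finset.card_product, Finset.card_product, Finset.card_univ, Fintype.card_fun,
      Fintype.card_bool, Fintype.card_fin, badCount]
    ring
  rw [← hu]
  refine le_trans (Finset.card_le_card ?_) ((Finset.card_union_le _ _).trans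
    (Nat.add_le_add_left (Finset.card_union_le _ _) _))
  rintro ⟨X, Y⟩ hXY
  simp only [Finset.mem_product, Finset.mem_filter, Finset.mem_union, Finset.mem_univ, true_and,
    and_true, goodLabels, bad] at hXY ⊢
  by_cases bX : Balanced e X
  · by_cases bY : Balanced e Y
    · left
      have hg : Good e X Y z := ⟨bX, bY, hXY.1.1, hXY.2, by omega, by omega⟩
      exact ⟨hg, restrict_ofPerm_eq _ i h1 h2 π _
        (hg.window (build_matches X Y z) he h1 h2 hj hXY.1.2)⟩
    · exact Or.inr (Or.inr bY)
  · exact Or.inr (Or.inl bX)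

open Classical in
/-- The pairs of a square permutation and a root with the pattern `π` around the root. -/
noncomputable def patternPairs (n : ℕ) (π : Equiv.Perm (Fin (2 * h + 1))) :
    Finset (Equiv.Perm (Fin n) × Fin n) :=
  Finset.univ.filter fun x => x.1 ∈ Sq n ∧ x ∈ patternEvent n π

/-- `build` sends good labels to square permutations, and `Good.unique` recovers the labels, so no
rooted permutation is counted twice. -/
theorem sum_goodLabels_le (e : ℕ) (π : Equiv.Perm (Fin (2 * h + 1))) :
    ∑ q : Fin n × Fin n, (goodLabels e π q.1 q.2).card ≤ (patternPairs n π).card := by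
  classical
  rw [← Finset.card_sigma]
  refine Finset.card_le_card_of_injOn (fun x => (build x.2.1 x.2.2 x.1.1, x.1.2)) ?_ ?_
  · rintro ⟨⟨z, i⟩, ⟨X, Y⟩⟩ hx
    rw [Finset.mem_coe, Finset.mem_sigma, goodLabels, Finset.mem_filter] at hx
    rw [Finset.mem_coe, patternPairs, Finset.mem_filter]
    exact ⟨Finset.mem_univ _, hx.2.2.1.mem_Sq (build_matches X Y z), hx.2.2.2⟩
  · rintro ⟨⟨z, i⟩, ⟨X, Y⟩⟩ hx ⟨⟨z', i'⟩, ⟨X', Y'⟩⟩ hx' heq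
    rw [Finset.mem_coe, Finset.mem_sigma, goodLabels, Finset.mem_filter] at hx hx'
    simp only [Prod.mk.injEq] at heq
    have hb := build_matches X' Y' z'
    rw [← heq.1] at hb
    obtain ⟨rfl, rfl, rfl⟩ := hx.2.2.1.unique hx'.2.2.1 (build_matches X Y z) hb
    rw [heq.2]

theorem sum_regions_le (m : ℕ) (f : Fin n × Fin n → ℕ) :
    ∑ q ∈ regionSet n m .one, f q + ∑ q ∈ regionSet n m .two, f q +
      ∑ q ∈ regionSet n m .three, f q + ∑ q ∈ regionSet n m .four, f q ≤ ∑ q, f q := by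
  classical
  unfold regionSet
  simp only [Finset.sum_filter, ← Finset.sum_add_distrib]
  refine Finset.sum_le_sum fun q _ => ?_
  split_ifs <;> simp only [Region] at * <;> omega

/-- Lower bound for the number of rooted square permutations with a given pattern. -/
theorem card_patternPairs_ge (he : h ≤ e) (π : Equiv.Perm (Fin (2 * h + 1))) :
    (regionSet n (8 * e) .one).card * ((psiCount .one π + psiCount .two π + psiCount .three π +
      psiCount .four π) * 2 ^ (n - (3 + (2 * h + 1))) * 2 ^ (n - 2)) ≤
      (patternPairs n π).card + 4 * n ^ 2 * (2 * (badCount n e * 2 ^ n)) := by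
  have h1 := (sum_regions_le (8 * e) fun q : Fin n × Fin n => (goodLabels e π q.1 q.2).card).trans
    (sum_goodLabels_le e π)
  have h2 : ∀ j, (regionSet n (8 * e) j).card *
      (psiCount j π * 2 ^ (n - (3 + (2 * h + 1))) * 2 ^ (n - 2)) ≤
      ∑ q ∈ regionSet n (8 * e) j, (goodLabels e π q.1 q.2).card +
        n ^ 2 * (2 * (badCount n e * 2 ^ n)) := by
    intro j
    have hc : (regionSet n (8 * e) j).card ≤ n ^ 2 := by
      refine (Finset.card_le_univ _).trans ?_
      simp [sq]
    refine le_trans ?_ (Nat.add_le_add_left (Nat.mul_le_mul_right _ hc) _)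
    rw [← smul_eq_mul, ← smul_eq_mul (a := (regionSet n (8 * e) j).card), ← Finset.sum_const,
      ← Finset.sum_const, ← Finset.sum_add_distrib]
    refine Finset.sum_le_sum fun q hq => ?_
    exact card_goodLabels_ge he (mem_regionSet.1 hq) π
  have a1 := h2 .one
  have a2 := h2 .two
  have a3 := h2 .three
  have a4 := h2 .four
  rw [card_regionSet_two] at a2
  rw [card_regionSet_three] at a3
  rw [card_regionSet_four] at a4
  nlinarith

end counting

/-! ### From counts to probabilities -/

theorem one_mem_Sq (n : ℕ) : (1 : Equiv.Perm (Fin n)) ∈ Sq n := fun _ => Or.inl fun _ hj => hj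

open Classical in
/-- The number of square permutations of size `n`. -/
noncomputable def sqCard (n : ℕ) : ℕ :=
  (Finset.univ.filter fun σ : Equiv.Perm (Fin n) => σ ∈ Sq n).card

theorem sqCard_pos (n : ℕ) : 0 < sqCard n := by
  rw [sqCard, Finset.card_pos]
  exact ⟨1, by simpa using one_mem_Sq n⟩

theorem uniformOn_real_singleton {α : Type*} [MeasurableSpace α] [MeasurableSingletonClass α]
    {s : Finset α} {a : α} (ha : a ∈ s) :
    (uniformOn (s : Set α)).real {a} = (s.card : ℝ)⁻¹ := by
  rw [measureReal_def, uniformOn, cond_apply s.measurableSet,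
    Set.inter_eq_right.2 (Set.singleton_subset_iff.2 (Finset.mem_coe.2 ha)),
    Measure.count_singleton, mul_one, Measure.count_apply_finset]
  simp

theorem rootedLaw_isProbabilityMeasure {n : ℕ} (hn : 0 < n) :
    IsProbabilityMeasure (rootedLaw n) := by
  have : NeZero n := ⟨hn.ne'⟩
  have : IsProbabilityMeasure (uniformOn (Sq n)) :=
    isProbabilityMeasure_uniformOn (Set.toFinite _) ⟨1, one_mem_Sq n⟩
  have : IsProbabilityMeasure (uniformOn (Set.univ : Set (Fin n))) :=
    isProbabilityMeasure_uniformOn (Set.toFinite _) Set.univ_nonempty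
  unfold rootedLaw
  infer_instance

theorem rootedLaw_real_singleton {n : ℕ} {σ : Equiv.Perm (Fin n)} (hσ : σ ∈ Sq n) (i : Fin n) :
    (rootedLaw n).real {(σ, i)} = ((sqCard n : ℝ) * n)⁻¹ := by
  classical
  have : IsProbabilityMeasure (uniformOn (Sq n)) :=
    isProbabilityMeasure_uniformOn (Set.toFinite _) ⟨1, one_mem_Sq n⟩
  have : IsProbabilityMeasure (uniformOn (Set.univ : Set (Fin n))) :=
    isProbabilityMeasure_uniformOn (Set.toFinite _) ⟨i, trivial⟩
  rw [← Set.singleton_prod_singleton, rootedLaw, measureReal_prod_prod]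
  have h1 := uniformOn_real_singleton
    (s := Finset.univ.filter fun σ : Equiv.Perm (Fin n) => σ ∈ Sq n) (a := σ) (by simpa using hσ)
  have h2 := uniformOn_real_singleton (s := (Finset.univ : Finset (Fin n))) (Finset.mem_univ i)
  rw [Finset.coe_filter_univ] at h1
  rw [Finset.coe_univ, Finset.card_univ, Fintype.card_fin] at h2
  rw [h2, mul_inv, sqCard, ← h1]
  rfl

theorem patternPairs_div_le {n h : ℕ} (hn : 0 < n) (π : Equiv.Perm (Fin (2 * h + 1))) :
    ((patternPairs n π).card : ℝ) / (sqCard n * n) ≤ (rootedLaw n).real (patternEvent n π) := by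
  classical
  have := rootedLaw_isProbabilityMeasure hn
  have hsub : (patternPairs n π : Set (Equiv.Perm (Fin n) × Fin n)) ⊆ patternEvent n π := by
    intro x hx
    rw [Finset.mem_coe, patternPairs, Finset.mem_filter] at hx
    exact hx.2.2
  refine le_trans ?_ (measureReal_mono hsub)
  rw [← sum_measureReal_singleton, Finset.sum_congr rfl fun x hx => ?_, Finset.sum_const,
    nsmul_eq_mul, div_eq_mul_inv]
  rw [patternPairs, Finset.mem_filter] at hx
  exact rootedLaw_real_singleton hx.2.1 x.2

theorem sum_patternEvent_le {n : ℕ} (h : ℕ) (hn : 0 < n) :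
    ∑ π : Equiv.Perm (Fin (2 * h + 1)), (rootedLaw n).real (patternEvent n π) ≤ 1 := by
  have := rootedLaw_isProbabilityMeasure hn
  rw [← measureReal_biUnion_finset]
  · exact measureReal_le_one
  · intro π _ π' _ hne
    rw [Function.onFun, Set.disjoint_left]
    intro x hx hx'
    exact hne (ofPerm_injective _ (hx.symm.trans hx'))
  · intro π _
    exact (Set.toFinite _).measurableSet

theorem badCount_mul_le (n e : ℕ) :
    (badCount n e : ℝ) * e ^ 4 ≤ 3 * (n + 1) * n ^ 2 * 2 ^ n := by
  have h := card_not_balanced_le n e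
  have h' : ((e : ℝ) ^ 4 * (badCount n e : ℝ)) ≤ (n + 1) * (3 * n ^ 2 * 2 ^ n) := by
    exact_mod_cast h
  linarith

/-! ### The quantitative lower bound and its limit -/

/-- The lower bound for a probability `P` of a pattern with error parameter `e`. -/
noncomputable def lowerBound (P n e : ℝ) : ℝ :=
  n / (n + 2) * ((1 - 64 * (e / n) - 8 * (1 / n)) * P - 768 * (1 + 1 / n) * (n ^ 3 / e ^ 4))

theorem lowerBound_le_div {n e k N F R b s : ℕ} {P : ℝ} (hn : 3 + k ≤ n) (he : 0 < e)
    (hs0 : (0 : ℝ) < s) (hs : (s : ℝ) ≤ (n + 2) * 2 ^ (n - 3) * 2 ^ (n - 2))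
    (hF : R * (N * 2 ^ (n - (3 + k)) * 2 ^ (n - 2)) ≤ F + 4 * n ^ 2 * (2 * (b * 2 ^ n)))
    (hR : n * n ≤ 4 * R + n * (8 * (8 * e) + 8))
    (hB : (b : ℝ) * e ^ 4 ≤ 3 * (n + 1) * n ^ 2 * 2 ^ n) (hp : P = (N : ℝ) / (4 * 2 ^ k)) :
    lowerBound P n e ≤ F / (s * n) := by
  obtain ⟨l, rfl⟩ : ∃ l, n = l + (3 + k) := ⟨n - (3 + k), by omega⟩
  have e1 : l + (3 + k) - (3 + k) = l := by omega
  have e2 : l + (3 + k) - 2 = l + k + 1 := by omega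
  have e3 : l + (3 + k) - 3 = l + k := by omega
  rw [e1, e2] at hF
  rw [e2, e3] at hs
  have e0 : (2 : ℝ) ^ (l + (3 + k)) = 8 * 2 ^ l * 2 ^ k := by rw [pow_add, pow_add]; ring
  have e5 : (2 : ℝ) ^ (l + k + 1) = 2 * 2 ^ l * 2 ^ k := by rw [pow_add, pow_add]; ring
  have e6 : (2 : ℝ) ^ (l + k) = 2 ^ l * 2 ^ k := by rw [pow_add]
  have hF' : (R : ℝ) * (N * 2 ^ l * 2 ^ (l + k + 1)) ≤
      F + 4 * ((l + (3 + k) : ℕ) : ℝ) ^ 2 * (2 * (b * 2 ^ (l + (3 + k)))) := by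
    exact_mod_cast hF
  have hR' : ((l + (3 + k) : ℕ) : ℝ) * ((l + (3 + k) : ℕ) : ℝ) ≤
      4 * R + ((l + (3 + k) : ℕ) : ℝ) * (8 * (8 * e) + 8) := by
    exact_mod_cast hR
  have hn0 : (0 : ℝ) < ((l + (3 + k) : ℕ) : ℝ) := by positivity
  set n' : ℝ := ((l + (3 + k) : ℕ) : ℝ)
  rw [e0] at hF' hB
  rw [e5] at hF' hs
  rw [e6] at hs
  set T : ℝ := 2 ^ l with hT
  set K : ℝ := 2 ^ k with hK
  have hT0 : 0 < T := by positivity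
  have hK0 : 0 < K := by positivity
  have he0 : (0 : ℝ) < e := by
    exact_mod_cast he
  have hpK : (N : ℝ) = P * (4 * K) := by rw [hp]; field_simp
  have hp0 : 0 ≤ P := by rw [hp]; positivity
  have hb : (b : ℝ) ≤ 3 * (n' + 1) * n' ^ 2 * (8 * T * K) / e ^ 4 := by
    rw [le_div_iff₀ (by positivity)]
    exact hB
  -- Replacing `s` by its upper bound requires a nonnegative bracket; when the bracket is negative,
  -- the claim is trivial.
  by_cases hneg : (1 - 64 * (e / n') - 8 * (1 / n')) * P -
      768 * (1 + 1 / n') * (n' ^ 3 / e ^ 4) < 0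
  · have hle : lowerBound P n' e ≤ 0 := by
      rw [lowerBound]
      exact mul_nonpos_of_nonneg_of_nonpos (by positivity) hneg.le
    exact hle.trans (by positivity)
  rw [not_lt] at hneg
  have hFl : 2 * T ^ 2 * K ^ 2 * n' ^ 2 * ((1 - 64 * (e / n') - 8 * (1 / n')) * P -
      768 * (1 + 1 / n') * (n' ^ 3 / e ^ 4)) ≤ F := by
    have a1 : (n' * n' - n' * (8 * (8 * e) + 8)) * (P * (2 * T ^ 2 * K ^ 2)) ≤
        (4 * R) * (P * (2 * T ^ 2 * K ^ 2)) :=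
      mul_le_mul_of_nonneg_right (by linarith) (by positivity)
    have a2 : 4 * n' ^ 2 * (2 * (b * (8 * T * K))) ≤ 4 * n' ^ 2 * (2 *
        ((3 * (n' + 1) * n' ^ 2 * (8 * T * K) / e ^ 4) * (8 * T * K))) := by gcongr
    have a3 : 2 * T ^ 2 * K ^ 2 * n' ^ 2 * ((1 - 64 * (e / n') - 8 * (1 / n')) * P -
        768 * (1 + 1 / n') * (n' ^ 3 / e ^ 4)) =
        (n' * n' - n' * (8 * (8 * e) + 8)) * (P * (2 * T ^ 2 * K ^ 2)) - 4 * n' ^ 2 * (2 *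
        ((3 * (n' + 1) * n' ^ 2 * (8 * T * K) / e ^ 4) * (8 * T * K))) := by
      field_simp
      ring
    rw [hpK] at hF'
    rw [a3]
    linarith
  rw [le_div_iff₀ (by positivity), lowerBound]
  refine le_trans ?_ hFl
  have hd : 0 ≤ (1 - 64 * (e / n') - 8 * (1 / n')) * P -
      768 * (1 + 1 / n') * (n' ^ 3 / e ^ 4) := hneg
  calc n' / (n' + 2) * ((1 - 64 * (e / n') - 8 * (1 / n')) * P -
      768 * (1 + 1 / n') * (n' ^ 3 / e ^ 4)) * (s * n')
      ≤ n' / (n' + 2) * ((1 - 64 * (e / n') - 8 * (1 / n')) * P -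
      768 * (1 + 1 / n') * (n' ^ 3 / e ^ 4)) *
        (((n' + 2) * (T * K) * (2 * T * K)) * n') := by
        gcongr
    _ = _ := by
        field_simp

theorem lowerBound_le {n e h : ℕ} (hh : 1 ≤ h) (he : h ≤ e) (hn : 2 * h + 4 ≤ n)
    (π : Equiv.Perm (Fin (2 * h + 1))) :
    lowerBound (p h π) n e ≤ (rootedLaw n).real (patternEvent n π) := by
  refine le_trans ?_ (patternPairs_div_le (by omega) π)
  exact lowerBound_le_div (k := 2 * h + 1) (by omega) (by omega)
    (by exact_mod_cast sqCard_pos n) (by exact_mod_cast card_Sq_le (n := n) (by omega))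
    (card_patternPairs_ge (n := n) he π) (sq_le_card_regionSet n (8 * e)) (badCount_mul_le n e)
    (p_eq hh π)

/-- The error parameter. -/
noncomputable def errorParam (n : ℕ) : ℕ := ⌈(n : ℝ) ^ (9 / 10 : ℝ)⌉₊

theorem tendsto_errorParam : Tendsto errorParam atTop atTop :=
  tendsto_nat_ceil_atTop.comp
    ((tendsto_rpow_atTop (by norm_num)).comp tendsto_natCast_atTop_atTop)

theorem tendsto_one_div : Tendsto (fun n : ℕ => 1 / (n : ℝ)) atTop (𝓝 0) :=
  tendsto_one_div_atTop_nhds_zero_nat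

theorem tendsto_errorParam_div : Tendsto (fun n : ℕ => (errorParam n : ℝ) / n) atTop (𝓝 0) := by
  have h1 : Tendsto (fun n : ℕ => (n : ℝ) ^ (-(1 / 10) : ℝ) + 1 / n) atTop (𝓝 (0 + 0)) :=
    ((tendsto_rpow_neg_atTop (by norm_num)).comp tendsto_natCast_atTop_atTop).add tendsto_one_div
  rw [add_zero] at h1
  refine squeeze_zero' (Eventually.of_forall fun n => by positivity) ?_ h1
  filter_upwards [eventually_gt_atTop 0] with n hn
  have hn' : (0 : ℝ) < n := by exact_mod_cast hn
  rw [div_le_iff₀ hn', add_mul, div_mul_cancel₀ _ hn'.ne']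
  have : (n : ℝ) ^ (-(1 / 10) : ℝ) * n = (n : ℝ) ^ (9 / 10 : ℝ) := by
    nth_rewrite 2 [← Real.rpow_one (n : ℝ)]
    rw [← Real.rpow_add hn']
    norm_num
  rw [this]
  exact (Nat.ceil_lt_add_one (by positivity)).le

/-- The errors vanish when `e / n` and `n ^ 3 / e ^ 4` both tend to 0; any exponent strictly between
3/4 and 1 would serve in place of 9/10. -/
theorem tendsto_cube_div_errorParam :
    Tendsto (fun n : ℕ => (n : ℝ) ^ 3 / (errorParam n : ℝ) ^ 4) atTop (𝓝 0) := by
  have h1 : Tendsto (fun n : ℕ => (n : ℝ) ^ (-(6 / 10) : ℝ)) atTop (𝓝 0) :=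
    (tendsto_rpow_neg_atTop (by norm_num)).comp tendsto_natCast_atTop_atTop
  refine squeeze_zero' (Eventually.of_forall fun n => by positivity) ?_ h1
  filter_upwards [eventually_gt_atTop 0] with n hn
  have hn' : (0 : ℝ) < n := by exact_mod_cast hn
  have h2 : (n : ℝ) ^ (9 / 10 : ℝ) ≤ errorParam n := Nat.le_ceil _
  have h3 : (0 : ℝ) < (n : ℝ) ^ (9 / 10 : ℝ) := Real.rpow_pos_of_pos hn' _
  have h4 : (n : ℝ) ^ 3 / ((n : ℝ) ^ (9 / 10 : ℝ)) ^ 4 = (n : ℝ) ^ (-(6 / 10) : ℝ) := by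
    rw [← Real.rpow_natCast, ← Real.rpow_natCast, ← Real.rpow_mul hn'.le, ← Real.rpow_sub hn']
    norm_num
  rw [← h4]
  gcongr

theorem tendsto_lowerBound (h : ℕ) (π : Equiv.Perm (Fin (2 * h + 1))) :
    Tendsto (fun n : ℕ => lowerBound (p h π) n (errorParam n)) atTop (𝓝 (p h π)) := by
  have h0 : Tendsto (fun n : ℕ => (n : ℝ) / (n + 2)) atTop (𝓝 1) :=
    tendsto_natCast_div_add_atTop 2
  have h1 := (((tendsto_const_nhds (x := (1 : ℝ))).sub
    (tendsto_errorParam_div.const_mul 64)).sub (tendsto_one_div.const_mul 8)).mul_const (p h π)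
  have h2 := (((tendsto_const_nhds (x := (1 : ℝ))).add tendsto_one_div).const_mul 768).mul
    tendsto_cube_div_errorParam
  have h3 := h0.mul (h1.sub h2)
  simp only [mul_zero, sub_zero, one_mul] at h3
  exact h3

end SquarePerm

/-! ### Convergence, by squeezing -/

theorem corollary6p6 (h : ℕ) (hh : 1 ≤ h) (π : Equiv.Perm (Fin (2 * h + 1))) :
    Filter.Tendsto
      (fun n : ℕ => (SquarePerm.rootedLaw n).real
        {x | SquarePerm.restrict h (SquarePerm.ofPerm x.1 x.2) =
          SquarePerm.ofPerm π ⟨h, by omega⟩})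
      Filter.atTop (nhds (SquarePerm.p h π)) := by
  classical
  change Tendsto (fun n : ℕ => (SquarePerm.rootedLaw n).real (SquarePerm.patternEvent n π)) _ _
  have hev : ∀ᶠ n : ℕ in atTop, ∀ τ : Equiv.Perm (Fin (2 * h + 1)),
      SquarePerm.lowerBound (SquarePerm.p h τ) n (SquarePerm.errorParam n) ≤
        (SquarePerm.rootedLaw n).real (SquarePerm.patternEvent n τ) := by
    filter_upwards [eventually_ge_atTop (2 * h + 4),
      SquarePerm.tendsto_errorParam.eventually_ge_atTop h] with n hn he τ
    exact SquarePerm.lowerBound_le hh he hn τ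
  -- The upper bound is what remains after subtracting the lower bounds for all other patterns; its
  -- limit is `p h π` because the limits sum to 1.
  have hup : Tendsto (fun n : ℕ => 1 - ∑ τ ∈ Finset.univ.erase π,
      SquarePerm.lowerBound (SquarePerm.p h τ) n (SquarePerm.errorParam n)) atTop (𝓝 (SquarePerm.p h π)) := by
    have h1 := (tendsto_const_nhds (x := (1 : ℝ)) (f := atTop (α := ℕ))).sub
      (tendsto_finsetSum (Finset.univ.erase π)
        fun τ _ => SquarePerm.tendsto_lowerBound h τ)
    convert h1 using 2
    rw [← SquarePerm.sum_p hh, ← Finset.add_sum_erase _ _ (Finset.mem_univ π), add_sub_cancel_right]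
  refine tendsto_of_tendsto_of_tendsto_of_le_of_le' (SquarePerm.tendsto_lowerBound h π) hup ?_ ?_
  · filter_upwards [hev] with n hn
    exact hn π
  · filter_upwards [hev, eventually_gt_atTop 0] with n hn hn0
    have h1 := SquarePerm.sum_patternEvent_le h hn0
    rw [← Finset.add_sum_erase _ _ (Finset.mem_univ π)] at h1
    have h2 := Finset.sum_le_sum fun τ (_ : τ ∈ Finset.univ.erase π) => hn τ
    linarith
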